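/- Let $\theta>0$. Let $W_1,W_2,\dots$ be i.i.d. with the beta$(1,\theta)$ distribution, with density $\theta(1-w)^{\theta-1}$ on $(0,1)$, and let $P_i=W_i\prod_{j<i}(1-W_j)$, so that $P=(P_1,P_2,\dots)$ has the GEM$(\theta)$ distribution. Let $\Pi$ be a $P$-biased random permutation of $\mathbb{N}_+=\{1,2,\dots\}$: given $P$, let $X_1,X_2,\dots$ be i.i.d. with distribution $P$, and let $(\Pi_1,\Pi_2,\dots)$ be the sequence of distinct values of $X_1,X_2,\dots$ in order of appearance (almost surely a permutation of $\mathbb{N}_+$). Say that $\Pi$ splits at $n\ge 1$ if $\Pi$ maps $\{1,\dots,n\}$ to itself, and let $u_n=\mathbb{P}(\Pi\text{ splits at }n)$ be the renewal probabilities. Then the limit $u_\infty=\lim_{n\to\infty}u_n$ exists, the infinite product below converges, and $$u_\infty=\frac{1}{1+\theta}\prod_{j=2}^{\infty}\frac{j(j+2\theta)}{(j+\theta)^2}=\frac{\Gamma(\theta+2)\,\Gamma(\theta+1)}{\Gamma(2\theta+2)}.$$ In particular, for $\theta=1$ we have $u_\infty=1/3$, and the length $Y_1=\min\{n\ge1:\Pi\text{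 splits at }n\}\in\mathbb{N}_+\cup\{\infty\}$ of the first component of $\Pi$ satisfies $\mathbb{E}\,Y_1=3$. -/

import Mathlib

open MeasureTheory ProbabilityTheory Filter Topology

open scoped ENNReal

/-! Positive integers are relabelled by `ℕ`: the natural number `i` stands for the positive
integer `i + 1`, so that `[n] = {1, …, n}` becomes `{i : ℕ | i < n}`. -/

/-- The stick-breaking weights `P i = (1 - w 0) ⋯ (1 - w (i-1)) * w i`. -/
noncomputable def stickBreaking (w : ℕ → ℝ) (i : ℕ) : ℝ :=
  (∏ j ∈ Finset.range i, (1 - w j)) * w i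

/-- The random sequence `P` has the GEM(`θ`) distribution: it is obtained by stick-breaking from
independent residual factors `W i`, all with the beta`(1, θ)` distribution. -/
def IsGEM {Ω : Type*} [MeasurableSpace Ω] (θ : ℝ) (μ : Measure Ω) (P : Ω → ℕ → ℝ) : Prop :=
  Measurable P ∧
    ∃ W : ℕ → Ω → ℝ, iIndepFun W μ ∧ (∀ i, HasLaw (W i) (betaMeasure 1 θ) μ) ∧
      ∀ᵐ ω ∂μ, P ω = stickBreaking (fun i => W i ω)

/-- Given the random discrete distribution `P`, the variables `X 0, X 1, …` are independent and
identically distributed with distribution `P`. This is the defining property of the conditional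
distribution given `P`: for every event `{P ∈ A}`,
`ℙ(P ∈ A, X 0 = x 0, …, X (n-1) = x (n-1)) = 𝔼[P (x 0) ⋯ P (x (n-1)) ; P ∈ A]`. -/
def IsSampleFrom {Ω : Type*} [MeasurableSpace Ω] (μ : Measure Ω) (P : Ω → ℕ → ℝ)
    (X : ℕ → Ω → ℕ) : Prop :=
  (∀ j, Measurable (X j)) ∧
    ∀ (n : ℕ) (x : Fin n → ℕ) (A : Set (ℕ → ℝ)), MeasurableSet A →
      μ {ω | P ω ∈ A ∧ ∀ i : Fin n, X i ω = x i} =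
        ∫⁻ ω in P ⁻¹' A, ∏ i : Fin n, ENNReal.ofReal (P ω (x i)) ∂μ

/-- `π` lists the distinct values of the sequence `x` in order of appearance: `π i = x (J i)`,
where `J 0 = 0` and `J (i + 1)` is the least `j > J i` such that `x j` is none of
`π 0, …, π i`. -/
def IsOrderOfAppearance (x π : ℕ → ℕ) : Prop :=
  ∃ J : ℕ → ℕ, J 0 = 0 ∧ (∀ i, π i = x (J i)) ∧
    ∀ i, IsLeast {j | J i < j ∧ ∀ k ≤ i, x j ≠ π k} (J (i + 1))

/-- `π` is a `P`-biased random permutation: the sequence of distinct values, in order of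
appearance, of a sample `X 0, X 1, …` from the random discrete distribution `P`. -/
def IsBiasedPermutation {Ω : Type*} [MeasurableSpace Ω] (μ : Measure Ω) (P : Ω → ℕ → ℝ)
    (π : Ω → Equiv.Perm ℕ) : Prop :=
  ∃ X : ℕ → Ω → ℕ, IsSampleFrom μ P X ∧
    ∀ᵐ ω ∂μ, IsOrderOfAppearance (fun j => X j ω) (π ω)

/-- `σ` splits at `n`: it maps the set of the first `n` labels to itself. -/
def SplitsAt (σ : Equiv.Perm ℕ) (n : ℕ) : Prop := ∀ i < n, σ i < n

/-- The renewal probability `u n`: the probability that the random permutation `π` splits at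
`n`. -/
noncomputable def renewalProb {Ω : Type*} [MeasurableSpace Ω] (μ : Measure Ω)
    (π : Ω → Equiv.Perm ℕ) (n : ℕ) : ℝ :=
  μ.real {ω | SplitsAt (π ω) n}

/-- The length of the first component of `σ`, that is, its least strictly positive splitting
time (infinite if there is none). -/
noncomputable def firstComponentLength (σ : Equiv.Perm ℕ) : ℕ∞ :=
  ⨅ (n : ℕ) (_ : 1 ≤ n ∧ SplitsAt σ n), (n : ℕ∞)

/-!
Condition on the weights `P`, obtained by stick-breaking from i.i.d. factors `W 0, W 1, …`, and put
`R n = (1 - W 0) ⋯ (1 - W (n - 1))`.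

*Law of the first values.* Following the list of distinct values of the sample shows that, given
`P`, the first values of `π` are `a 0, …, a n` with probability
`P (a 0) ∏ k, P (a (k + 1)) / (1 - P (a 0) - ⋯ - P (a k))`
(`IsBiasedPermutation.measure_firstValues`, in terms of `listProb`). Lists of values are written
with the latest value first, so that a new value is added by `List.cons`.

*Splitting probability.* The sum of these products over the orderings of a finite set is an
integral over the time of a Poisson process that carries the draws (`sum_seenTime_orderings`). It
yields `u n = ∫ exp (-x) * G n x` over `x > 0`, where `G n x` is the mean of the product over
`i < n` of `1 - exp (-x * P i / R n)`, and conditioning on the last factor gives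
`G (n + 1) x = 𝔼[(1 - exp (-x * W / (1 - W))) * G n (x / (1 - W))]`. In terms of Laplace transforms
this recursion becomes much simpler (`lintegral_laplace_step`):
`G n x = x ^ θ / Γ(θ) * ∫ r ^ (θ - 1) * exp (-x * r) * k n r` over `r > 0`, with `k 0 = 1` and
`k (n + 1) r = (1 + r)⁻¹ * 𝔼[k n (r * (1 - W))]`; here `k` is called `damping`. The function
`(1 + r) ^ (-(θ + 1))` is a fixed point, to which `k n` converges geometrically (`damping_bounds`).
Hence `u n`, which equals `θ * ∫ r ^ (θ - 1) * (1 + r) ^ (-(θ + 1)) * k n r`, tends to a beta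
integral, whose value is the ratio of Gamma functions. Euler's limit formula for the Gamma function
identifies the infinite product (`tprod_gamma_product`).

*Mean length of the first component.* If the first `k` values are an ordering of the first `k`
labels, the remaining ones form a permutation biased by the weights of `W k, W (k + 1), …`, which
are independent of `W 0, …, W (k - 1)` (`measure_firstValues_append`). So the splitting times
satisfy the renewal equation, which gives `∑ k ≤ n, ℙ(Y > k) * u (n - k) = 1` for the length `Y` of
the first component (`sum_mul_eq_one_of_renewal`). The limit of partial sums shows that
`∑ k, ℙ(Y > k)` is finite, after which dominated convergence gives `𝔼 Y = 1 / u`.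
-/

/-! ### Order of appearance -/

/-- The first `n` values of `π`, the latest one first. -/
def firstValues (π : ℕ → ℕ) : ℕ → List ℕ
  | 0 => []
  | n + 1 => π n :: firstValues π n

/-- The distinct values among `x 0, …, x (m - 1)`, the latest to appear first. -/
def distinctValues (x : ℕ → ℕ) : ℕ → List ℕ
  | 0 => []
  | m + 1 => if x m ∈ distinctValues x m then distinctValues x m else x m :: distinctValues x m

/-- The word `y` is read in the sequence `x` from position `m` on. -/
def ReadsFrom (x : ℕ → ℕ) : ℕ → List ℕ → Prop
  | _, [] => True
  | m, a :: y => x m = a ∧ ReadsFrom x (m + 1) y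

theorem length_firstValues (π : ℕ → ℕ) (n : ℕ) : (firstValues π n).length = n := by
  induction n with
  | zero => rfl
  | succ n ih => simp [firstValues, ih]

theorem mem_firstValues {π : ℕ → ℕ} {n a : ℕ} : a ∈ firstValues π n ↔ ∃ i < n, π i = a := by
  induction n with
  | zero => simp [firstValues]
  | succ n ih =>
    simp only [firstValues, List.mem_cons, ih]
    constructor
    · rintro (rfl | ⟨i, hi, rfl⟩)
      · exact ⟨n, by omega, rfl⟩
      · exact ⟨i, by omega, rfl⟩
    · rintro ⟨i, hi, rfl⟩
      rcases Nat.lt_succ_iff_lt_or_eq.1 hi with h | rfl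
      · exact Or.inr ⟨i, h, rfl⟩
      · exact Or.inl rfl

theorem distinctValues_succ_eq_cons {x : ℕ → ℕ} {m l : ℕ} {L : List ℕ} (hl : l ∉ L) :
    distinctValues x (m + 1) = l :: L ↔
      (distinctValues x m = l :: L ∧ x m ∈ l :: L) ∨ (distinctValues x m = L ∧ x m = l) := by
  rw [distinctValues]
  split_ifs with h
  · constructor
    · intro h'
      exact Or.inl ⟨h', h' ▸ h⟩
    · rintro (h' | ⟨h1, h2⟩)
      · exact h'.1
      · subst h1 h2; exact absurd h hl
  · constructor
    · intro h'
      rw [List.cons.injEq] at h'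
      exact Or.inr ⟨h'.2, h'.1⟩
    · rintro (⟨h1, h2⟩ | ⟨h1, h2⟩)
      · exact absurd (h1 ▸ h2) h
      · rw [h1, h2]

theorem distinctValues_succ_ne_nil {x : ℕ → ℕ} {m : ℕ} : distinctValues x (m + 1) ≠ [] := by
  rw [distinctValues]
  split_ifs with h
  · exact List.ne_nil_of_mem h
  · simp

theorem length_distinctValues_mono (x : ℕ → ℕ) :
    Monotone fun m => (distinctValues x m).length := by
  refine monotone_nat_of_le_succ fun m => ?_
  simp only [distinctValues]
  split_ifs <;> simp

/-- If `π` lists the values of `x` in order of appearance, then just before the first occurrence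
of `π n` the values seen are `π 0, …, π (n - 1)`. -/
theorem IsOrderOfAppearance.distinctValues_eq {x π : ℕ → ℕ} {J : ℕ → ℕ} (h0 : J 0 = 0)
    (hx : ∀ i, π i = x (J i))
    (hJ : ∀ i, IsLeast {j | J i < j ∧ ∀ k ≤ i, x j ≠ π k} (J (i + 1))) (n : ℕ) :
    distinctValues x (J n) = firstValues π n ∧
      ∀ m, J n < m → m ≤ J (n + 1) → distinctValues x m = firstValues π (n + 1) := by
  have key : ∀ n, distinctValues x (J n) = firstValues π n →
      ∀ m, J n < m → m ≤ J (n + 1) → distinctValues x m = firstValues π (n + 1) := by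
    intro n hn m hm
    induction m, hm using Nat.le_induction with
    | base =>
      intro _
      rw [distinctValues, hn, ← hx, if_neg]
      · rfl
      · intro h
        obtain ⟨i, hi, h⟩ := mem_firstValues.1 h
        cases n with
        | zero => omega
        | succ n => exact (hJ n).1.2 i (by omega) (by rw [← hx, h])
    | succ m hm ih =>
      intro hm'
      have : x m ∈ firstValues π (n + 1) := by
        by_contra h
        have : J (n + 1) ≤ m := (hJ n).2 ⟨hm, fun k hk e =>
          h (mem_firstValues.2 ⟨k, by omega, e.symm⟩)⟩
        omega
      rw [distinctValues, ih (by omega), if_pos this]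
  have main : ∀ n, distinctValues x (J n) = firstValues π n := by
    intro n
    induction n with
    | zero => rw [h0]; rfl
    | succ n ih => exact key n ih _ (hJ n).1.1 le_rfl
  exact ⟨main n, key n (main n)⟩

theorem IsOrderOfAppearance.firstValues_succ_iff {x π : ℕ → ℕ} (h : IsOrderOfAppearance x π)
    {n l : ℕ} {L : List ℕ} (hn : L.length = n) (hl : l ∉ L) :
    firstValues π (n + 1) = l :: L ↔ ∃ m, distinctValues x m = L ∧ x m = l := by
  obtain ⟨J, h0, hx, hJ⟩ := h
  have hD := IsOrderOfAppearance.distinctValues_eq h0 hx hJ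
  constructor
  · intro h
    rw [firstValues, List.cons.injEq] at h
    exact ⟨J n, (hD n).1.trans h.2, by rw [← hx, h.1]⟩
  · rintro ⟨m, hm, hml⟩
    have hmono : StrictMono J := strictMono_nat_of_lt_succ fun i => (hJ i).1.1
    have hlen : ∀ i, L = firstValues π i → i = n := by
      rintro i rfl; rw [← hn, length_firstValues]
    have hmJ : m = J n := by
      obtain ⟨i, hi⟩ : ∃ i, m ≤ J i := ⟨m, hmono.le_apply⟩
      classical
      have hs := Nat.find_spec (⟨i, hi⟩ : ∃ i, m ≤ J i)
      have hmin := fun k => Nat.find_min (⟨i, hi⟩ : ∃ i, m ≤ J i) (m := k)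
      generalize Nat.find (⟨i, hi⟩ : ∃ i, m ≤ J i) = i at hs hmin
      cases i with
      | zero =>
        have : m = J 0 := by omega
        rw [← hlen 0 (by rw [← hm, this, (hD 0).1]), this]
      | succ i =>
        have hi' : J i < m := not_le.1 (hmin i (by omega))
        have e := (hD i).2 m hi' hs
        have := hlen (i + 1) (by rw [← hm, e])
        subst this
        by_contra hne
        have : J (i + 1) ≤ m := (hJ i).2 ⟨hi', fun k hk ek => hl (by
          rw [← hm, e, ← hml]; exact mem_firstValues.2 ⟨k, by omega, ek.symm⟩)⟩
        omega
    subst hmJ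
    rw [firstValues, hx, hml, ← (hD n).1, hm]

/-! ### Sampling from a discrete distribution -/

theorem measurableSet_distinctValues (m : ℕ) (L : List ℕ) :
    MeasurableSet {x : ℕ → ℕ | distinctValues x m = L} := by
  induction m generalizing L with
  | zero => simp [distinctValues]
  | succ m ih =>
    have h : {x : ℕ → ℕ | distinctValues x (m + 1) = L} =
        ({x | distinctValues x m = L} ∩ ⋃ a ∈ {a | a ∈ L}, {x | x m = a}) ∪
        ⋃ l, ⋃ L' ∈ {L' | l :: L' = L ∧ l ∉ L'}, {x | distinctValues x m = L'} ∩ {x | x m = l} := by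
      ext x
      simp only [Set.mem_ofPred_eq, distinctValues, Set.mem_union, Set.mem_inter_iff, Set.mem_iUnion,
        exists_prop]
      split_ifs with hx
      · constructor
        · rintro rfl; exact Or.inl ⟨rfl, _, hx, rfl⟩
        · rintro (h | ⟨l, L', ⟨h1, h2⟩, rfl, rfl⟩)
          · exact h.1
          · exact absurd hx h2
      · constructor
        · intro h; exact Or.inr ⟨_, _, ⟨h, hx⟩, rfl, rfl⟩
        · rintro (⟨rfl, _, h, rfl⟩ | ⟨l, L', ⟨rfl, h2⟩, rfl, rfl⟩)
          · exact absurd h hx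
          · rfl
    have hm : ∀ a, MeasurableSet {x : ℕ → ℕ | x m = a} := fun a =>
      measurableSet_eq_fun (measurable_pi_apply m) measurable_const
    rw [h]
    refine ((ih L).inter (.biUnion (Set.to_countable _) fun a _ => hm a)).union
      (.iUnion fun l => .biUnion (Set.to_countable _) fun L' _ => (ih L').inter (hm l))

theorem measurableSet_readsFrom (m : ℕ) (y : List ℕ) :
    MeasurableSet {x : ℕ → ℕ | ReadsFrom x m y} := by
  induction y generalizing m with
  | nil => simp [ReadsFrom]
  | cons a y ih =>
    exact (measurableSet_eq_fun (measurable_pi_apply m) measurable_const).inter (ih (m + 1))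

theorem readsFrom_iff {x : ℕ → ℕ} {m : ℕ} {y : List ℕ} :
    ReadsFrom x m y ↔ ∀ i : Fin y.length, x (m + i) = y.get i := by
  induction y generalizing m with
  | nil => simp [ReadsFrom]
  | cons a y ih =>
    rw [ReadsFrom, ih]
    constructor
    · rintro ⟨h1, h2⟩ i
      refine Fin.cases ?_ (fun j => ?_) i
      · simpa using h1
      · have := h2 j
        simp only [List.get_eq_getElem] at this
        simp only [List.length_cons, Fin.val_succ, List.get_eq_getElem, List.getElem_cons_succ]
        rw [← this]; congr 1; omega
    · intro h
      refine ⟨by simpa using h 0, fun j => ?_⟩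
      have := h j.succ
      simp only [List.length_cons, Fin.val_succ, List.get_eq_getElem,
        List.getElem_cons_succ] at this
      simp only [List.get_eq_getElem]
      rw [← this]; congr 1; omega

/-- For a sample from the fixed distribution `p`, the probability that the distinct values among
the first `m` draws are those listed in `L`, in that order (the latest first). -/
noncomputable def seenProb (p : ℕ → ℝ≥0∞) : ℕ → List ℕ → ℝ≥0∞
  | 0, [] => 1
  | 0, _ :: _ => 0
  | _ + 1, [] => 0
  | m + 1, l :: L => seenProb p m (l :: L) * ((l :: L).map p).sum + seenProb p m L * p l

/-- For a sample from the fixed distribution `p`, the expected number of times at which the list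
of values seen is `L` (the latest first). -/
noncomputable def seenTime (p : ℕ → ℝ≥0∞) : List ℕ → ℝ≥0∞
  | [] => 1
  | l :: L => seenTime p L * p l * (1 - ((l :: L).map p).sum)⁻¹

/-- For a sample from the fixed distribution `p`, the probability that the first distinct values
are those listed in `L`, in that order (the latest first). -/
noncomputable def listProb (p : ℕ → ℝ≥0∞) (L : List ℕ) : ℝ≥0∞ :=
  seenTime p L * (1 - (L.map p).sum)

theorem listProb_nil (p : ℕ → ℝ≥0∞) : listProb p [] = 1 := by simp [listProb, seenTime]

theorem listProb_cons {p : ℕ → ℝ≥0∞} {l : ℕ} {L : List ℕ} (h : ((l :: L).map p).sum < 1) :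
    listProb p (l :: L) = seenTime p L * p l := by
  rw [listProb, seenTime, mul_assoc, ENNReal.inv_mul_cancel, mul_one]
  · exact (tsub_pos_of_lt h).ne'
  · exact (tsub_le_self.trans_lt ENNReal.one_lt_top).ne

theorem seenTime_lt_top {p : ℕ → ℝ≥0∞} {L : List ℕ} (h : (L.map p).sum < 1) :
    seenTime p L < ∞ := by
  induction L with
  | nil => simp [seenTime]
  | cons l L ih =>
    have h' := h
    rw [List.map_cons, List.sum_cons] at h'
    refine ENNReal.mul_lt_top (ENNReal.mul_lt_top (ih (le_add_self.trans_lt h'))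
      ((le_self_add.trans_lt h').trans ENNReal.one_lt_top)) ?_
    rw [ENNReal.inv_lt_top]
    exact tsub_pos_of_lt h

theorem tsum_eq_of_succ_eq {a b : ℕ → ℝ≥0∞} {s : ℝ≥0∞} (h0 : a 0 = 0)
    (h : ∀ m, a (m + 1) = a m * s + b m) (hs : s < 1) (hb : ∑' m, b m < ∞) :
    ∑' m, a m = (∑' m, b m) * (1 - s)⁻¹ := by
  have hs0 : 1 - s ≠ 0 := (tsub_pos_of_lt hs).ne'
  have hs1 : 1 - s ≠ ∞ := (tsub_le_self.trans_lt ENNReal.one_lt_top).ne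
  have hadd : ∀ B : ℝ≥0∞, B * (1 - s)⁻¹ * s + B = B * (1 - s)⁻¹ := by
    intro B
    calc B * (1 - s)⁻¹ * s + B = B * (1 - s)⁻¹ * s + B * ((1 - s)⁻¹ * (1 - s)) := by
          rw [ENNReal.inv_mul_cancel hs0 hs1, mul_one]
      _ = B * (1 - s)⁻¹ * (s + (1 - s)) := by ring
      _ = _ := by rw [add_tsub_cancel_of_le hs.le, mul_one]
  set B := ∑' m, b m with hB
  have hle : ∀ N, ∑ m ∈ Finset.range N, a m ≤ B * (1 - s)⁻¹ := by
    intro N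
    induction N with
    | zero => simp
    | succ N ih =>
      rw [Finset.sum_range_succ', h0, add_zero]
      simp only [h, Finset.sum_add_distrib, ← Finset.sum_mul]
      rw [← hadd B]
      gcongr
      exact ENNReal.sum_le_tsum _
  have hfin : ∑' m, a m ≤ B * (1 - s)⁻¹ := by
    rw [ENNReal.tsum_eq_iSup_nat]; exact iSup_le hle
  have hfin' : ∑' m, a m < ∞ :=
    hfin.trans_lt (ENNReal.mul_lt_top hb (ENNReal.inv_lt_top.2 (tsub_pos_of_lt hs)))
  have heq : ∑' m, a m = (∑' m, a m) * s + B := by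
    conv_lhs => rw [tsum_eq_zero_add' ENNReal.summable, h0, zero_add]
    simp only [h, ENNReal.tsum_add, ENNReal.tsum_mul_right]
    rfl
  rw [← ENNReal.div_eq_inv_mul.trans (mul_comm _ _), ENNReal.eq_div_iff hs0 hs1, mul_comm,
    ENNReal.mul_sub fun _ _ => hfin'.ne, mul_one]
  nth_rewrite 1 [heq]
  exact ENNReal.add_sub_cancel_left
    (ENNReal.mul_lt_top hfin' (hs.trans ENNReal.one_lt_top)).ne

theorem tsum_seenProb {p : ℕ → ℝ≥0∞} {L : List ℕ} (h : (L.map p).sum < 1) :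
    ∑' m, seenProb p m L = seenTime p L := by
  induction L with
  | nil =>
    rw [tsum_eq_single 0]
    · rfl
    · rintro (_ | m) hm
      · exact absurd rfl hm
      · rfl
  | cons l L ih =>
    have h' := h
    rw [List.map_cons, List.sum_cons] at h'
    have hL := le_add_self.trans_lt h'
    have hl := (le_self_add.trans_lt h').trans ENNReal.one_lt_top
    rw [tsum_eq_of_succ_eq (b := fun m => seenProb p m L * p l) (s := ((l :: L).map p).sum) rfl
      (fun m => rfl) h, ENNReal.tsum_mul_right, ih hL]
    · rfl
    · rw [ENNReal.tsum_mul_right, ih hL]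
      exact ENNReal.mul_lt_top (seenTime_lt_top hL) hl

theorem measurable_sum_map (L : List ℕ) : Measurable fun p : ℕ → ℝ≥0∞ => (L.map p).sum := by
  induction L with
  | nil => simp
  | cons l L ih =>
    simp only [List.map_cons, List.sum_cons]
    exact (measurable_pi_apply l).add ih

theorem measurable_seenProb (m : ℕ) (L : List ℕ) :
    Measurable fun p : ℕ → ℝ≥0∞ => seenProb p m L := by
  induction m generalizing L with
  | zero => cases L <;> exact measurable_const
  | succ m ih =>
    cases L with
    | nil => exact measurable_const
    | cons l L => exact ((ih _).mul (measurable_sum_map _)).add ((ih _).mul (measurable_pi_apply l))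

section Sample

variable {Ω : Type*} [MeasurableSpace Ω] {μ : Measure Ω} {P : Ω → ℕ → ℝ} {X : ℕ → Ω → ℕ}

theorem IsSampleFrom.measure_distinctValues_readsFrom (hX : IsSampleFrom μ P X)
    (hP : Measurable P) (m : ℕ) {L : List ℕ} (hL : L.Nodup) (y : List ℕ) :
    μ {ω | distinctValues (X · ω) m = L ∧ ReadsFrom (X · ω) m y} =
      ∫⁻ ω, seenProb (fun i => ENNReal.ofReal (P ω i)) m L *
        (y.map fun i => ENNReal.ofReal (P ω i)).prod ∂μ := by
  have hXm : Measurable fun ω => (X · ω) := measurable_pi_lambda _ hX.1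
  have hpm : Measurable fun ω => fun i => ENNReal.ofReal (P ω i) :=
    measurable_pi_lambda _ fun i => ((measurable_pi_apply i).comp hP).ennreal_ofReal
  have hmeas : ∀ m L y,
      MeasurableSet {ω | distinctValues (X · ω) m = L ∧ ReadsFrom (X · ω) m y} := fun m L y =>
    hXm ((measurableSet_distinctValues m L).inter (measurableSet_readsFrom m y))
  have hprod : ∀ y : List ℕ, Measurable fun ω => (y.map fun i => ENNReal.ofReal (P ω i)).prod := by
    intro y
    induction y with
    | nil => simp
    | cons l L ih =>
      simp only [List.map_cons, List.prod_cons]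
      exact ((measurable_pi_apply l).comp hpm).mul ih
  induction m generalizing L y with
  | zero =>
    cases L with
    | cons l L => simp [distinctValues, seenProb]
    | nil =>
      have := hX.2 y.length y.get Set.univ .univ
      simp only [Set.mem_univ, true_and, Set.preimage_univ, Measure.restrict_univ] at this
      simp only [distinctValues, true_and, readsFrom_iff, zero_add, seenProb, one_mul]
      rw [this]
      refine lintegral_congr fun ω => ?_
      rw [← List.prod_ofFn]
      congr 1
      conv_rhs => rw [← List.ofFn_get y, List.map_ofFn]
      rfl
  | succ m ih =>
    cases L with
    | nil => simp [distinctValues_succ_ne_nil, seenProb]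
    | cons l L =>
      obtain ⟨hl, hL'⟩ := List.nodup_cons.1 hL
      have hset : {ω | distinctValues (X · ω) (m + 1) = l :: L ∧ ReadsFrom (X · ω) (m + 1) y} =
          (⋃ a ∈ (l :: L).toFinset,
            {ω | distinctValues (X · ω) m = l :: L ∧ ReadsFrom (X · ω) m (a :: y)}) ∪
          {ω | distinctValues (X · ω) m = L ∧ ReadsFrom (X · ω) m (l :: y)} := by
        ext ω
        simp only [Set.mem_ofPred_eq, distinctValues_succ_eq_cons hl, Set.mem_union, Set.mem_iUnion,
          exists_prop, List.mem_toFinset, ReadsFrom]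
        constructor
        · rintro ⟨h1 | h1, h2⟩
          · exact Or.inl ⟨_, h1.2, h1.1, rfl, h2⟩
          · exact Or.inr ⟨h1.1, h1.2, h2⟩
        · rintro (⟨a, ha, h1, rfl, h2⟩ | ⟨h1, h3, h2⟩)
          · exact ⟨Or.inl ⟨h1, ha⟩, h2⟩
          · exact ⟨Or.inr ⟨h1, h3⟩, h2⟩
      have hsp : ∀ L, Measurable fun ω => seenProb (fun i => ENNReal.ofReal (P ω i)) m L :=
        fun L => (measurable_seenProb m L).comp hpm
      rw [hset, measure_union _ (hmeas _ _ _), measure_biUnion_finset _ fun a _ => hmeas _ _ _]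
      · simp only [ih hL, ih hL']
        have hm : ∀ L y : List ℕ, Measurable fun ω => seenProb (fun i => ENNReal.ofReal (P ω i)) m L *
            (y.map fun i => ENNReal.ofReal (P ω i)).prod := fun L y => (hsp L).mul (hprod y)
        rw [← lintegral_finsetSum _ fun a _ => hm _ _, ← lintegral_add_right _ (hm _ _)]
        refine lintegral_congr fun ω => ?_
        rw [seenProb, ← List.sum_toFinset _ hL, add_mul]
        simp only [List.map_cons, List.prod_cons, mul_assoc, Finset.sum_mul, Finset.mul_sum]
      · intro a _ b _ hab
        refine Set.disjoint_left.2 fun ω h1 h2 => hab ?_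
        exact h1.2.1.symm.trans h2.2.1
      · refine Set.disjoint_left.2 fun ω h1 h2 => ?_
        simp only [Set.mem_iUnion, Set.mem_ofPred_eq] at h1
        obtain ⟨_, _, h1, _⟩ := h1
        exact List.cons_ne_self _ _ (h1.symm.trans h2.1)

/-- The law of the first values of a biased permutation: the conditional probability given `P` of
seeing the list `L` is `listProb P L`. -/
theorem IsBiasedPermutation.measure_firstValues {π : Ω → Equiv.Perm ℕ} [IsProbabilityMeasure μ]
    (hπ : IsBiasedPermutation μ P π) (hP : Measurable P) {L : List ℕ} (hL : L.Nodup)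
    (hlt : ∀ᵐ ω ∂μ, (L.map fun i => ENNReal.ofReal (P ω i)).sum < 1) :
    NullMeasurableSet {ω | firstValues (π ω) L.length = L} μ ∧
    μ {ω | firstValues (π ω) L.length = L} =
      ∫⁻ ω, listProb (fun i => ENNReal.ofReal (P ω i)) L ∂μ := by
  obtain ⟨X, hX, hord⟩ := hπ
  cases L with
  | nil => simp [firstValues, listProb_nil]
  | cons l L =>
    obtain ⟨hl, hL'⟩ := List.nodup_cons.1 hL
    have hXm : Measurable fun ω => (X · ω) := measurable_pi_lambda _ hX.1
    have hpm : Measurable fun ω => fun i => ENNReal.ofReal (P ω i) :=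
      measurable_pi_lambda _ fun i => ((measurable_pi_apply i).comp hP).ennreal_ofReal
    have hae : {ω | firstValues (π ω) (l :: L).length = l :: L} =ᵐ[μ]
        ⋃ m, {ω | distinctValues (X · ω) m = L ∧ ReadsFrom (X · ω) m [l]} := by
      filter_upwards [hord] with ω h
      refine propext (Iff.trans (h.firstValues_succ_iff rfl hl) ?_)
      change _ ↔ ω ∈ ⋃ m, {ω | distinctValues (X · ω) m = L ∧ ReadsFrom (X · ω) m [l]}
      simp [ReadsFrom]
    have hmeas : ∀ m,
        MeasurableSet {ω | distinctValues (X · ω) m = L ∧ ReadsFrom (X · ω) m [l]} := fun m =>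
      hXm ((measurableSet_distinctValues m L).inter (measurableSet_readsFrom m [l]))
    refine ⟨(MeasurableSet.iUnion hmeas).nullMeasurableSet.congr hae.symm, ?_⟩
    rw [measure_congr hae, measure_iUnion _ hmeas]
    · simp only [hX.measure_distinctValues_readsFrom hP _ hL']
      rw [← lintegral_tsum]
      · refine lintegral_congr_ae ?_
        filter_upwards [hlt] with ω h
        rw [listProb_cons h, ENNReal.tsum_mul_right, tsum_seenProb]
        · simp
        · rw [List.map_cons, List.sum_cons] at h
          exact le_add_self.trans_lt h
      · intro m
        refine Measurable.aemeasurable (Measurable.mul ((measurable_seenProb m L).comp hpm) ?_)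
        simp only [List.map_cons, List.map_nil, List.prod_cons, List.prod_nil, mul_one]
        exact (measurable_pi_apply l).comp hpm
    · -- after the step at which `l` is seen, the list of values seen is longer than `L`
      have key : ∀ m m' ω, m < m' → distinctValues (X · ω) m = L → X m ω = l →
          distinctValues (X · ω) m' ≠ L := by
        intro m m' ω hmm h1 h2 h3
        have h4 := length_distinctValues_mono (X · ω) (Nat.succ_le_of_lt hmm)
        simp only [Nat.succ_eq_add_one, (distinctValues_succ_eq_cons hl).2 (Or.inr ⟨h1, h2⟩), h3,
          List.length_cons] at h4
        omega
      intro m m' hmm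
      refine Set.disjoint_left.2 fun ω h1 h2 => ?_
      rcases lt_or_gt_of_ne hmm with h | h
      · exact key m m' ω h h1.1 h1.2.1 h2.1
      · exact key m' m ω h h2.1 h2.2.1 h1.1

end Sample

/-! ### Orderings of a finite set and splitting times -/

/-- The lists in which each element of `S` occurs exactly once. -/
noncomputable def orderings (S : Finset ℕ) : Finset (List ℕ) := S.toList.permutations.toFinset

theorem mem_orderings {S : Finset ℕ} {L : List ℕ} :
    L ∈ orderings S ↔ L.Nodup ∧ L.toFinset = S := by
  rw [orderings, List.mem_toFinset, List.mem_permutations]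
  constructor
  · intro h
    exact ⟨h.nodup_iff.2 S.nodup_toList, by rw [List.toFinset_eq_of_perm _ _ h, S.toList_toFinset]⟩
  · rintro ⟨h, rfl⟩
    exact (List.toFinset_toList h).symm

theorem length_of_mem_orderings {S : Finset ℕ} {L : List ℕ} (h : L ∈ orderings S) :
    L.length = S.card := by
  obtain ⟨h1, rfl⟩ := mem_orderings.1 h
  exact (List.toFinset_card_of_nodup h1).symm

theorem sum_map_of_mem_orderings {M : Type*} [AddCommMonoid M] {S : Finset ℕ} {L : List ℕ}
    (h : L ∈ orderings S) (f : ℕ → M) : (L.map f).sum = ∑ i ∈ S, f i := by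
  obtain ⟨h1, rfl⟩ := mem_orderings.1 h
  exact (List.sum_toFinset f h1).symm

theorem firstValues_eq_iff {π ρ : ℕ → ℕ} {n : ℕ} :
    firstValues π n = firstValues ρ n ↔ ∀ i < n, π i = ρ i := by
  induction n with
  | zero => simp [firstValues]
  | succ n ih =>
    rw [firstValues, firstValues, List.cons.injEq, ih, Nat.forall_lt_succ_right, and_comm]

theorem firstValues_add (π : ℕ → ℕ) (k m : ℕ) :
    firstValues π (k + m) = firstValues (fun i => π (k + i)) m ++ firstValues π k := by
  induction m with
  | zero => rfl
  | succ m ih => rw [← add_assoc, firstValues, ih]; rfl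

theorem firstValues_map (f : ℕ → ℕ) (π : ℕ → ℕ) (n : ℕ) :
    firstValues (fun i => f (π i)) n = (firstValues π n).map f := by
  induction n with
  | zero => rfl
  | succ n ih => rw [firstValues, ih]; rfl

theorem firstValues_mem_orderings_range {π : ℕ → ℕ} {n : ℕ}
    (hπ : ∀ i < n, ∀ j < n, π i = π j → i = j) (h : ∀ i < n, π i < n) :
    firstValues π n ∈ orderings (Finset.range n) := by
  have hnd : ∀ m ≤ n, (firstValues π m).Nodup := by
    intro m hm
    induction m with
    | zero => simp [firstValues]
    | succ m ih =>
      refine List.nodup_cons.2 ⟨fun h => ?_, ih (by omega)⟩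
      obtain ⟨i, hi, h⟩ := mem_firstValues.1 h
      have := hπ i (by omega) m (by omega) h
      omega
  refine mem_orderings.2 ⟨hnd n le_rfl, Finset.eq_of_subset_of_card_le ?_ ?_⟩
  · intro a ha
    obtain ⟨i, hi, rfl⟩ := mem_firstValues.1 (List.mem_toFinset.1 ha)
    exact Finset.mem_range.2 (h i hi)
  · rw [List.toFinset_card_of_nodup (hnd n le_rfl), length_firstValues, Finset.card_range]

theorem splitsAt_iff {σ : Equiv.Perm ℕ} {n : ℕ} :
    SplitsAt σ n ↔ firstValues σ n ∈ orderings (Finset.range n) := by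
  constructor
  · exact fun h => firstValues_mem_orderings_range (fun i _ j _ h => σ.injective h) h
  · intro h i hi
    rw [← Finset.mem_range, ← (mem_orderings.1 h).2, List.mem_toFinset]
    exact mem_firstValues.2 ⟨i, hi, rfl⟩

/-- `k` is the first strictly positive splitting time of `σ`. -/
def FirstSplitsAt (σ : Equiv.Perm ℕ) (k : ℕ) : Prop :=
  SplitsAt σ k ∧ ∀ j, 1 ≤ j → j < k → ¬ SplitsAt σ j

open scoped Classical in
/-- The orderings of `{0, …, k - 1}` which are the first `k` values of a permutation that splits
at `k` for the first time. -/
noncomputable def indecomposableOrderings (k : ℕ) : Finset (List ℕ) :=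
  (orderings (Finset.range k)).filter fun L =>
    ∃ σ : Equiv.Perm ℕ, FirstSplitsAt σ k ∧ firstValues σ k = L

theorem firstSplitsAt_iff {σ : Equiv.Perm ℕ} {k : ℕ} :
    FirstSplitsAt σ k ↔ firstValues σ k ∈ indecomposableOrderings k := by
  classical
  rw [indecomposableOrderings, Finset.mem_filter]
  constructor
  · exact fun h => ⟨splitsAt_iff.1 h.1, σ, h, rfl⟩
  · rintro ⟨h, τ, hτ, he⟩
    refine ⟨splitsAt_iff.2 h, fun j h1 hj hs => hτ.2 j h1 hj fun i hi => ?_⟩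
    rw [firstValues_eq_iff.1 he i (by omega)]
    exact hs i hi

/-- A permutation which splits at `k` for the first time and at `k + m` is made of an
indecomposable permutation of the first block and of a permutation of the second one. -/
theorem firstSplitsAt_and_splitsAt_iff {σ : Equiv.Perm ℕ} {k m : ℕ} :
    FirstSplitsAt σ k ∧ SplitsAt σ (k + m) ↔ ∃ L ∈ indecomposableOrderings k,
      ∃ M ∈ orderings (Finset.range m), firstValues σ (k + m) = M.map (k + ·) ++ L := by
  constructor
  · rintro ⟨h1, h2⟩
    have hge : ∀ i, k ≤ σ (k + i) := by
      -- the labels below `k` are already taken by the first `k` values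
      intro i
      by_contra! hlt
      have h3 := (mem_orderings.1 (splitsAt_iff.1 h1.1)).2
      rw [← Finset.mem_range, ← h3, List.mem_toFinset] at hlt
      obtain ⟨j, hj, hji⟩ := mem_firstValues.1 hlt
      have := σ.injective hji
      omega
    refine ⟨_, firstSplitsAt_iff.1 h1, firstValues (fun i => σ (k + i) - k) m,
      firstValues_mem_orderings_range ?_ ?_, ?_⟩
    · intro i _ j _ h
      have h1 := hge i
      have h2 := hge j
      have := σ.injective (show σ (k + i) = σ (k + j) by omega)
      omega
    · intro i hi
      have h1 := hge i
      have := h2 (k + i) (by omega)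
      omega
    · rw [← firstValues_map, firstValues_add]
      congr 2
      ext i
      have := hge i
      omega
  · rintro ⟨L, hL, M, hM, h⟩
    rw [firstValues_add] at h
    have hlen := length_of_mem_orderings hM
    rw [Finset.card_range] at hlen
    obtain ⟨h1, h2⟩ := List.append_inj h (by rw [length_firstValues, List.length_map, hlen])
    have hk : FirstSplitsAt σ k := firstSplitsAt_iff.2 (h2 ▸ hL)
    refine ⟨hk, fun i hi => ?_⟩
    rcases lt_or_ge i k with hik | hik
    · have := hk.1 i hik
      omega
    · have : σ i ∈ M.map (k + ·) := by
        rw [← h1]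
        exact mem_firstValues.2 ⟨i - k, by omega, by congr 1; omega⟩
      obtain ⟨a, ha, hai⟩ := List.mem_map.1 this
      have := Finset.mem_range.1 ((mem_orderings.1 hM).2 ▸ List.mem_toFinset.2 ha)
      omega

/-! ### Stick-breaking with independent identically distributed factors -/

theorem sum_stickBreaking (w : ℕ → ℝ) (k : ℕ) :
    ∑ i ∈ Finset.range k, stickBreaking w i = 1 - ∏ j ∈ Finset.range k, (1 - w j) := by
  induction k with
  | zero => simp
  | succ k ih => rw [Finset.sum_range_succ, ih, Finset.prod_range_succ, stickBreaking]; ring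

theorem stickBreaking_add (w : ℕ → ℝ) (k i : ℕ) :
    stickBreaking w (k + i) =
      (∏ j ∈ Finset.range k, (1 - w j)) * stickBreaking (fun i => w (k + i)) i := by
  rw [stickBreaking, stickBreaking, Finset.prod_range_add, mul_assoc]

theorem residual_pos {w : ℕ → ℝ} (hw : ∀ i, w i ∈ Set.Ioo (0 : ℝ) 1) (k : ℕ) :
    0 < ∏ j ∈ Finset.range k, (1 - w j) :=
  Finset.prod_pos fun j _ => by linarith [(hw j).2]

theorem stickBreaking_pos {w : ℕ → ℝ} (hw : ∀ i, w i ∈ Set.Ioo (0 : ℝ) 1) (i : ℕ) :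
    0 < stickBreaking w i := mul_pos (residual_pos hw i) (hw i).1

/-- The stick-breaking weights as extended nonnegative numbers. -/
noncomputable def stickWeight (w : ℕ → ℝ) (i : ℕ) : ℝ≥0∞ := ENNReal.ofReal (stickBreaking w i)

theorem one_sub_sum_stickWeight {w : ℕ → ℝ} (hw : ∀ i, w i ∈ Set.Ioo (0 : ℝ) 1) (k : ℕ) :
    1 - ∑ i ∈ Finset.range k, stickWeight w i =
      ENNReal.ofReal (∏ j ∈ Finset.range k, (1 - w j)) := by
  simp only [stickWeight]
  rw [← ENNReal.ofReal_sum_of_nonneg fun i _ => (stickBreaking_pos hw i).le, sum_stickBreaking,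
    ← ENNReal.ofReal_one, ← ENNReal.ofReal_sub, sub_sub_cancel]
  rw [← sum_stickBreaking]
  exact Finset.sum_nonneg fun i _ => (stickBreaking_pos hw i).le

theorem sum_stickWeight_lt_one {w : ℕ → ℝ} (hw : ∀ i, w i ∈ Set.Ioo (0 : ℝ) 1) {L : List ℕ}
    (hL : L.Nodup) : (L.map (stickWeight w)).sum < 1 := by
  rw [← List.sum_toFinset _ hL]
  obtain ⟨N, hN⟩ := L.toFinset.exists_nat_subset_range
  refine (Finset.sum_le_sum_of_subset hN).trans_lt ?_
  by_contra! h
  have h1 := one_sub_sum_stickWeight hw N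
  rw [tsub_eq_zero_of_le h] at h1
  exact (ENNReal.ofReal_pos.2 (residual_pos hw N)).ne h1

theorem listProb_stickWeight_append {w : ℕ → ℝ} (hw : ∀ i, w i ∈ Set.Ioo (0 : ℝ) 1) {k : ℕ}
    {L : List ℕ} (hL : L ∈ orderings (Finset.range k)) (M : List ℕ) :
    listProb (stickWeight w) (M.map (k + ·) ++ L) =
      listProb (stickWeight w) L * listProb (stickWeight fun i => w (k + i)) M := by
  set R := ENNReal.ofReal (∏ j ∈ Finset.range k, (1 - w j)) with hR
  have hR0 : R ≠ 0 := (ENNReal.ofReal_pos.2 (residual_pos hw k)).ne'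
  have hRt : R ≠ ∞ := ENNReal.ofReal_ne_top
  have hLR : 1 - (L.map (stickWeight w)).sum = R := by
    rw [sum_map_of_mem_orderings hL, one_sub_sum_stickWeight hw]
  have hp : ∀ i, stickWeight w (k + i) = R * stickWeight (fun i => w (k + i)) i := fun i => by
    rw [stickWeight, stickBreaking_add, ENNReal.ofReal_mul (residual_pos hw k).le]; rfl
  have hsum : ∀ M : List ℕ, 1 - ((M.map (k + ·) ++ L).map (stickWeight w)).sum =
      R * (1 - (M.map (stickWeight fun i => w (k + i))).sum) := by
    intro M
    rw [List.map_append, List.sum_append, add_comm, tsub_add_eq_tsub_tsub, hLR,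
      ENNReal.mul_sub fun _ _ => hRt, mul_one, List.map_map, ← List.sum_map_mul_left]
    congr 2
    exact List.map_congr_left fun i _ => hp i
  have htime : seenTime (stickWeight w) (M.map (k + ·) ++ L) =
      seenTime (stickWeight w) L * seenTime (stickWeight fun i => w (k + i)) M := by
    induction M with
    | nil => simp [seenTime]
    | cons a M ih =>
      have := hsum (a :: M)
      rw [List.map_cons, List.cons_append] at this ⊢
      rw [seenTime, ih, this, hp, seenTime, ENNReal.mul_inv (Or.inl hR0) (Or.inl hRt)]
      calc _ = seenTime (stickWeight w) L * (seenTime (stickWeight fun i => w (k + i)) M *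
            stickWeight (fun i => w (k + i)) a * (1 - ((a :: M).map
            (stickWeight fun i => w (k + i))).sum)⁻¹) * (R * R⁻¹) := by ring
        _ = _ := by rw [ENNReal.mul_inv_cancel hR0 hRt, mul_one]
  rw [listProb, listProb, listProb, htime, hsum, hLR]
  ring

theorem listProb_congr {p q : ℕ → ℝ≥0∞} {L : List ℕ} (h : ∀ i ∈ L, p i = q i) :
    listProb p L = listProb q L := by
  have : seenTime p L = seenTime q L := by
    induction L with
    | nil => rfl
    | cons l L ih =>
      rw [seenTime, seenTime, ih fun i hi => h i (List.mem_cons_of_mem _ hi),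
        h l List.mem_cons_self, List.map_congr_left h]
  rw [listProb, listProb, this, List.map_congr_left h]

theorem measurable_listProb (L : List ℕ) : Measurable fun p : ℕ → ℝ≥0∞ => listProb p L := by
  have : Measurable fun p : ℕ → ℝ≥0∞ => seenTime p L := by
    induction L with
    | nil => exact measurable_const
    | cons l L ih =>
      exact (ih.mul (measurable_pi_apply l)).mul
        (measurable_const.sub (measurable_sum_map _)).inv
  exact this.mul (measurable_const.sub (measurable_sum_map _))

theorem measurable_stickWeight : Measurable stickWeight := by
  refine measurable_pi_lambda _ fun i => Measurable.ennreal_ofReal ?_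
  unfold stickBreaking
  fun_prop

/-- The sequence `w` with its terms of index at least `k` replaced by `0`. -/
def truncate (k : ℕ) (w : ℕ → ℝ) (i : ℕ) : ℝ := if i < k then w i else 0

theorem measurable_truncate (k : ℕ) : Measurable (truncate k) := by
  refine measurable_pi_lambda _ fun i => ?_
  unfold truncate
  split_ifs <;> fun_prop

theorem stickBreaking_truncate {w : ℕ → ℝ} {k i : ℕ} (hi : i < k) :
    stickBreaking (truncate k w) i = stickBreaking w i := by
  rw [stickBreaking, stickBreaking, truncate, if_pos hi]
  congr 1
  refine Finset.prod_congr rfl fun j hj => ?_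
  rw [truncate, if_pos ((Finset.mem_range.1 hj).trans hi)]

section Independent

variable {Ω : Type*} [MeasurableSpace Ω] {μ : Measure Ω} {W : ℕ → Ω → ℝ} {ν : Measure ℝ}

theorem indepFun_truncate_shift (hm : ∀ i, Measurable (W i)) (hind : iIndepFun W μ) (k : ℕ) :
    IndepFun (fun ω => truncate k fun i => W i ω) (fun ω i => W (k + i) ω) μ := by
  have h := indep_iSup_of_disjoint (m := fun i => MeasurableSpace.comap (W i) inferInstance)
    (fun i => (hm i).comap_le) hind (S := Set.Iio k) (T := Set.Ici k)
    (Set.disjoint_left.2 fun i h1 h2 => not_lt.2 (Set.mem_Ici.1 h2) (Set.mem_Iio.1 h1))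
  rw [IndepFun_iff_Indep]
  refine indep_of_indep_of_le_left (indep_of_indep_of_le_right h ?_) ?_
  · rw [MeasurableSpace.pi, MeasurableSpace.comap_iSup]
    refine iSup_le fun i => ?_
    rw [MeasurableSpace.comap_comp]
    exact le_iSup₂_of_le (k + i) (Nat.le_add_right k i) le_rfl
  · rw [MeasurableSpace.pi, MeasurableSpace.comap_iSup]
    refine iSup_le fun i => ?_
    rw [MeasurableSpace.comap_comp]
    by_cases hi : i < k
    · refine le_iSup₂_of_le i hi (le_of_eq ?_)
      congr 1
      ext ω
      exact if_pos hi
    · have : (fun x : ℕ → ℝ => x i) ∘ (fun ω => truncate k fun i => W i ω) = fun _ => 0 := by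
        ext ω
        exact if_neg hi
      rw [this, MeasurableSpace.comap_const]
      exact bot_le

/-- The terms of index less than `k` of an i.i.d. sequence are independent of the shifted sequence,
which is distributed like the sequence itself. -/
theorem lintegral_truncate_shift [IsProbabilityMeasure μ] (hm : ∀ i, Measurable (W i))
    (hind : iIndepFun W μ) (hlaw : ∀ i, μ.map (W i) = ν) (k : ℕ) {H : (ℕ → ℝ) → (ℕ → ℝ) → ℝ≥0∞}
    (hH : Measurable (Function.uncurry H)) :
    ∫⁻ ω, H (truncate k fun i => W i ω) (fun i => W (k + i) ω) ∂μ =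
      ∫⁻ ω, ∫⁻ ω', H (truncate k fun i => W i ω') (fun i => W i ω) ∂μ ∂μ := by
  have hW : Measurable fun ω i => W i ω := measurable_pi_lambda _ hm
  have hT : Measurable fun ω => truncate k fun i => W i ω := (measurable_truncate k).comp hW
  have hS : Measurable fun ω i => W (k + i) ω := measurable_pi_lambda _ fun i => hm _
  have hshift : μ.map (fun ω i => W (k + i) ω) = μ.map (fun ω i => W i ω) := by
    rw [(hind.precomp (add_right_injective k)).map_fun_eq_infinitePi_map fun i => hm _,
      hind.map_fun_eq_infinitePi_map hm]
    simp only [hlaw]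
  have h1 := (indepFun_iff_map_prod_eq_prod_map_map hT.aemeasurable hS.aemeasurable).1
    (indepFun_truncate_shift hm hind k)
  rw [hshift] at h1
  have : IsProbabilityMeasure (μ.map fun ω => truncate k fun i => W i ω) :=
    Measure.isProbabilityMeasure_map hT.aemeasurable
  have : IsProbabilityMeasure (μ.map fun ω i => W i ω) :=
    Measure.isProbabilityMeasure_map hW.aemeasurable
  calc _ = ∫⁻ z, Function.uncurry H z ∂(μ.map fun ω =>
        (truncate k fun i => W i ω, fun i => W (k + i) ω)) := by
        rw [lintegral_map hH (hT.prodMk hS)]; rfl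
    _ = _ := by
        rw [h1, lintegral_prod_symm _ hH.aemeasurable, lintegral_map _ hW]
        · refine lintegral_congr fun ω => ?_
          rw [lintegral_map _ hT]
          · rfl
          · exact hH.comp (measurable_id.prodMk measurable_const)
        · exact hH.lintegral_prod_left'

end Independent

section Renewal

variable {Ω : Type*} [MeasurableSpace Ω] {μ : Measure Ω} [IsProbabilityMeasure μ]
  {P : Ω → ℕ → ℝ} {π : Ω → Equiv.Perm ℕ} {W : ℕ → Ω → ℝ} {ν : Measure ℝ}

theorem measure_firstValues_stickBreaking (hW : ∀ i ω, W i ω ∈ Set.Ioo (0 : ℝ) 1)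
    (hP : Measurable P) (hPW : ∀ᵐ ω ∂μ, P ω = stickBreaking fun i => W i ω)
    (hπ : IsBiasedPermutation μ P π) {n : ℕ} {L : List ℕ} (hL : L.Nodup) (hn : L.length = n) :
    NullMeasurableSet {ω | firstValues (π ω) n = L} μ ∧
    μ {ω | firstValues (π ω) n = L} =
      ∫⁻ ω, listProb (stickWeight fun i => W i ω) L ∂μ := by
  subst hn
  have h := hπ.measure_firstValues hP hL (by
    filter_upwards [hPW] with ω h
    rw [h]
    exact sum_stickWeight_lt_one (fun i => hW i ω) hL)
  refine ⟨h.1, h.2.trans (lintegral_congr_ae ?_)⟩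
  filter_upwards [hPW] with ω h
  rw [h]; rfl

theorem measure_firstValues_append (hm : ∀ i, Measurable (W i))
    (hW : ∀ i ω, W i ω ∈ Set.Ioo (0 : ℝ) 1) (hind : iIndepFun W μ) (hlaw : ∀ i, μ.map (W i) = ν)
    (hP : Measurable P) (hPW : ∀ᵐ ω ∂μ, P ω = stickBreaking fun i => W i ω)
    (hπ : IsBiasedPermutation μ P π) {k m : ℕ} {L M : List ℕ}
    (hL : L ∈ orderings (Finset.range k)) (hM : M ∈ orderings (Finset.range m)) :
    NullMeasurableSet {ω | firstValues (π ω) (k + m) = M.map (k + ·) ++ L} μ ∧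
    μ {ω | firstValues (π ω) (k + m) = M.map (k + ·) ++ L} =
      μ {ω | firstValues (π ω) k = L} * μ {ω | firstValues (π ω) m = M} := by
  have hL' := mem_orderings.1 hL
  have hM' := mem_orderings.1 hM
  have hLl := length_of_mem_orderings hL
  have hMl := length_of_mem_orderings hM
  rw [Finset.card_range] at hLl hMl
  have hnd : (M.map (k + ·) ++ L).Nodup := by
    refine List.Nodup.append (hM'.1.map (add_right_injective k)) hL'.1 ?_
    intro a h1 h2
    obtain ⟨b, _, rfl⟩ := List.mem_map.1 h1
    have := Finset.mem_range.1 (hL'.2 ▸ List.mem_toFinset.2 h2)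
    omega
  have h := measure_firstValues_stickBreaking hW hP hPW hπ hnd (n := k + m)
    (by rw [List.length_append, List.length_map, hLl, hMl, add_comm])
  refine ⟨h.1, ?_⟩
  have hF : ∀ L, Measurable fun w : ℕ → ℝ => listProb (stickWeight w) L := fun L =>
    (measurable_listProb L).comp measurable_stickWeight
  have htr : ∀ w, listProb (stickWeight w) L = listProb (stickWeight (truncate k w)) L := by
    intro w
    refine listProb_congr fun i hi => ?_
    rw [stickWeight, stickWeight, stickBreaking_truncate]
    exact Finset.mem_range.1 (hL'.2 ▸ List.mem_toFinset.2 hi)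
  rw [h.2, (measure_firstValues_stickBreaking hW hP hPW hπ hL'.1 hLl).2,
    (measure_firstValues_stickBreaking hW hP hPW hπ hM'.1 hMl).2]
  simp only [listProb_stickWeight_append (fun i => hW i _) hL]
  rw [lintegral_congr fun ω => congrArg₂ (· * ·) (htr _) rfl, lintegral_congr fun ω => htr _,
    lintegral_truncate_shift hm hind hlaw k
    (H := fun a b => listProb (stickWeight a) L * listProb (stickWeight b) M)
    (((hF L).comp measurable_fst).mul ((hF M).comp measurable_snd))]
  have hWm : Measurable fun ω i => W i ω := measurable_pi_lambda _ hm
  have h1 : Measurable fun ω => listProb (stickWeight fun i => W i ω) M := (hF M).comp hWm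
  have h2 : Measurable fun ω => listProb (stickWeight (truncate k fun i => W i ω)) L :=
    ((hF L).comp (measurable_truncate k)).comp hWm
  rw [← lintegral_const_mul _ h1]
  exact lintegral_congr fun ω => lintegral_mul_const _ h2

theorem measure_firstValues_mem (hW : ∀ i ω, W i ω ∈ Set.Ioo (0 : ℝ) 1)
    (hP : Measurable P) (hPW : ∀ᵐ ω ∂μ, P ω = stickBreaking fun i => W i ω)
    (hπ : IsBiasedPermutation μ P π) {n : ℕ} {T : Finset (List ℕ)}
    (hT : T ⊆ orderings (Finset.range n)) :
    NullMeasurableSet {ω | firstValues (π ω) n ∈ T} μ ∧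
    μ {ω | firstValues (π ω) n ∈ T} = ∑ L ∈ T, μ {ω | firstValues (π ω) n = L} := by
  have h : ∀ L ∈ T, NullMeasurableSet {ω | firstValues (π ω) n = L} μ := fun L hL =>
    (measure_firstValues_stickBreaking hW hP hPW hπ (mem_orderings.1 (hT hL)).1 (by
      simpa using length_of_mem_orderings (hT hL))).1
  have he : {ω | firstValues (π ω) n ∈ T} = ⋃ L ∈ T, {ω | firstValues (π ω) n = L} := by
    ext ω; simp
  rw [he]
  refine ⟨.biUnion (Set.to_countable _) h, measure_biUnion_finset₀ ?_ h⟩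
  intro L _ M _ hLM
  refine Disjoint.aedisjoint (Set.disjoint_left.2 fun ω h1 h2 => hLM ?_)
  exact h1.symm.trans h2

theorem nullMeasurableSet_splitsAt (hW : ∀ i ω, W i ω ∈ Set.Ioo (0 : ℝ) 1)
    (hP : Measurable P) (hPW : ∀ᵐ ω ∂μ, P ω = stickBreaking fun i => W i ω)
    (hπ : IsBiasedPermutation μ P π) (n : ℕ) :
    NullMeasurableSet {ω | SplitsAt (π ω) n} μ := by
  simp only [splitsAt_iff]
  exact (measure_firstValues_mem hW hP hPW hπ subset_rfl).1

/-- The splitting times regenerate: after the first one, the rest of the permutation is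
distributed like the permutation itself. -/
theorem measure_firstSplitsAt_and_splitsAt (hm : ∀ i, Measurable (W i))
    (hW : ∀ i ω, W i ω ∈ Set.Ioo (0 : ℝ) 1) (hind : iIndepFun W μ) (hlaw : ∀ i, μ.map (W i) = ν)
    (hP : Measurable P) (hPW : ∀ᵐ ω ∂μ, P ω = stickBreaking fun i => W i ω)
    (hπ : IsBiasedPermutation μ P π) (k m : ℕ) :
    μ {ω | FirstSplitsAt (π ω) k ∧ SplitsAt (π ω) (k + m)} =
      μ {ω | FirstSplitsAt (π ω) k} * μ {ω | SplitsAt (π ω) m} := by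
  classical
  have hsub : indecomposableOrderings k ⊆ orderings (Finset.range k) := Finset.filter_subset _ _
  have h1 := (measure_firstValues_mem hW hP hPW hπ hsub).2
  have h2 := (measure_firstValues_mem hW hP hPW hπ (n := m) subset_rfl).2
  simp only [← firstSplitsAt_iff] at h1
  simp only [← splitsAt_iff] at h2
  have he : {ω | FirstSplitsAt (π ω) k ∧ SplitsAt (π ω) (k + m)} =
      ⋃ p ∈ indecomposableOrderings k ×ˢ orderings (Finset.range m),
        {ω | firstValues (π ω) (k + m) = p.2.map (k + ·) ++ p.1} := by
    ext ω
    simp [firstSplitsAt_and_splitsAt_iff, and_assoc]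
  have happ : ∀ p ∈ indecomposableOrderings k ×ˢ orderings (Finset.range m), _ := fun p hp =>
    measure_firstValues_append hm hW hind hlaw hP hPW hπ
      (hsub (Finset.mem_product.1 hp).1) (Finset.mem_product.1 hp).2
  rw [he, measure_biUnion_finset₀ _ fun p hp => (happ p hp).1, h1, h2, Finset.sum_mul_sum,
    ← Finset.sum_product']
  · exact Finset.sum_congr rfl fun p hp => (happ p hp).2
  · intro p hp q hq hpq
    refine Disjoint.aedisjoint (Set.disjoint_left.2 fun ω e1 e2 => hpq ?_)
    have e := e1.symm.trans e2
    obtain ⟨e3, e4⟩ := List.append_inj e (by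
      simp only [List.length_map, length_of_mem_orderings (Finset.mem_product.1 hp).2,
        length_of_mem_orderings (Finset.mem_product.1 hq).2])
    exact Prod.ext e4 (List.map_injective_iff.2 (add_right_injective k) e3)

end Renewal

/-! ### The splitting probability given the weights -/

theorem sum_orderings {M : Type*} [AddCommMonoid M] {S : Finset ℕ} (hS : S.Nonempty)
    (F : List ℕ → M) :
    ∑ L ∈ orderings S, F L = ∑ i ∈ S, ∑ L ∈ orderings (S.erase i), F (i :: L) := by
  have h : orderings S = S.biUnion fun i => (orderings (S.erase i)).image (i :: ·) := by
    ext L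
    simp only [Finset.mem_biUnion, Finset.mem_image, mem_orderings]
    constructor
    · rintro ⟨h1, rfl⟩
      cases L with
      | nil => simp at hS
      | cons i L =>
        obtain ⟨h2, h3⟩ := List.nodup_cons.1 h1
        refine ⟨i, by simp, L, ⟨h3, ?_⟩, rfl⟩
        rw [List.toFinset_cons, Finset.erase_insert (by simpa using h2)]
    · rintro ⟨i, hi, L, ⟨h1, h2⟩, rfl⟩
      refine ⟨List.nodup_cons.2 ⟨fun h => ?_, h1⟩, ?_⟩
      · have := h2 ▸ List.mem_toFinset.2 h
        simp at this
      · rw [List.toFinset_cons, h2, Finset.insert_erase hi]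
  rw [h, Finset.sum_biUnion]
  · refine Finset.sum_congr rfl fun i _ => Finset.sum_image fun L _ M _ h => ?_
    exact (List.cons.inj h).2
  · intro i _ j _ hij
    refine Finset.disjoint_left.2 fun L h1 h2 => hij ?_
    obtain ⟨L', _, rfl⟩ := Finset.mem_image.1 h1
    obtain ⟨L'', _, h⟩ := Finset.mem_image.1 h2
    exact (List.cons.inj h).1.symm

section Poissonization

variable {p : ℕ → ℝ}

theorem exp_neg_mul_prod_eq (p : ℕ → ℝ) (S : Finset ℕ) (t : ℝ) :
    Real.exp (-t) * ∏ i ∈ S, (Real.exp (p i * t) - 1) =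
      Real.exp (-((1 - ∑ i ∈ S, p i) * t)) * ∏ i ∈ S, (1 - Real.exp (-(p i * t))) := by
  have h : ∀ i, Real.exp (p i * t) - 1 = Real.exp (p i * t) * (1 - Real.exp (-(p i * t))) :=
    fun i => by rw [mul_sub, ← Real.exp_add]; simp
  simp only [h, Finset.prod_mul_distrib]
  rw [← Real.exp_sum, ← mul_assoc, ← Real.exp_add, ← Finset.sum_mul]
  congr 2
  ring

theorem exp_neg_mul_prod_nonneg (hp : ∀ i, 0 ≤ p i) (S : Finset ℕ) {t : ℝ} (ht : 0 ≤ t) :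
    0 ≤ Real.exp (-t) * ∏ i ∈ S, (Real.exp (p i * t) - 1) :=
  mul_nonneg (Real.exp_pos _).le (Finset.prod_nonneg fun i _ =>
    sub_nonneg.2 (Real.one_le_exp (mul_nonneg (hp i) ht)))

theorem exp_neg_mul_prod_le (hp : ∀ i, 0 ≤ p i) (S : Finset ℕ) {t : ℝ} (ht : 0 ≤ t) :
    Real.exp (-t) * ∏ i ∈ S, (Real.exp (p i * t) - 1) ≤
      Real.exp (-((1 - ∑ i ∈ S, p i) * t)) := by
  rw [exp_neg_mul_prod_eq]
  refine mul_le_of_le_one_right (Real.exp_pos _).le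
    (Finset.prod_le_one (fun i _ => ?_) fun i _ => ?_)
  · exact sub_nonneg.2 (Real.exp_le_one_iff.2 (neg_nonpos.2 (mul_nonneg (hp i) ht)))
  · exact sub_le_self _ (Real.exp_pos _).le

theorem integrableOn_exp_neg_mul_prod (hp : ∀ i, 0 ≤ p i) {S : Finset ℕ}
    (hS : ∑ i ∈ S, p i < 1) :
    IntegrableOn (fun t => Real.exp (-t) * ∏ i ∈ S, (Real.exp (p i * t) - 1)) (Set.Ioi 0) := by
  refine Integrable.mono' (g := fun t => Real.exp (-(1 - ∑ i ∈ S, p i) * t))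
    (exp_neg_integrableOn_Ioi 0 (sub_pos.2 hS)) ?_ ?_
  · exact Continuous.aestronglyMeasurable (by fun_prop)
  · refine ae_restrict_of_forall_mem measurableSet_Ioi fun t ht => ?_
    rw [Real.norm_of_nonneg (exp_neg_mul_prod_nonneg hp S (le_of_lt ht)), neg_mul]
    exact exp_neg_mul_prod_le hp S (le_of_lt ht)

/-- Integration of the derivative of `exp (-t) * ∏ i ∈ S, (exp (p i * t) - 1)` over `(0, ∞)`. -/
theorem integral_exp_neg_mul_prod_recursion (hp : ∀ i, 0 ≤ p i) {S : Finset ℕ}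
    (hS : ∑ i ∈ S, p i < 1) (hne : S.Nonempty) :
    (1 - ∑ i ∈ S, p i) *
        ∫ t in Set.Ioi 0, Real.exp (-t) * ∏ i ∈ S, (Real.exp (p i * t) - 1) =
      ∑ i ∈ S, p i *
        ∫ t in Set.Ioi 0, Real.exp (-t) * ∏ j ∈ S.erase i, (Real.exp (p j * t) - 1) := by
  have hSe : ∀ i, ∑ j ∈ S.erase i, p j < 1 := fun i =>
    (Finset.sum_le_sum_of_subset_of_nonneg (Finset.erase_subset i S) fun j _ _ => hp j).trans_lt hS
  set F : Finset ℕ → ℝ → ℝ := fun S t => Real.exp (-t) * ∏ i ∈ S, (Real.exp (p i * t) - 1) with hF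
  have hderiv : ∀ t, HasDerivAt (F S)
      (∑ i ∈ S, p i * F (S.erase i) t - (1 - ∑ i ∈ S, p i) * F S t) t := by
    intro t
    have h1 : HasDerivAt (fun t => ∏ i ∈ S, (Real.exp (p i * t) - 1))
        (∑ i ∈ S, (∏ j ∈ S.erase i, (Real.exp (p j * t) - 1)) • (Real.exp (p i * t) * p i)) t := by
      refine HasDerivAt.fun_finsetProd fun i _ => ?_
      have := ((hasDerivAt_id t).const_mul (p i)).exp.sub_const 1
      simpa using this
    have h2 : HasDerivAt (fun t => Real.exp (-t)) (-Real.exp (-t)) t := by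
      simpa using (hasDerivAt_neg t).exp
    refine (h2.mul h1).congr_deriv ?_
    have h3 : ∀ i ∈ S, (∏ j ∈ S.erase i, (Real.exp (p j * t) - 1)) • (Real.exp (p i * t) * p i) =
        p i * ∏ j ∈ S.erase i, (Real.exp (p j * t) - 1) +
          p i * ∏ j ∈ S, (Real.exp (p j * t) - 1) := by
      intro i hi
      rw [← Finset.mul_prod_erase S (fun j => Real.exp (p j * t) - 1) hi, smul_eq_mul]
      ring
    rw [Finset.sum_congr rfl h3, Finset.sum_add_distrib, ← Finset.sum_mul, hF, mul_add,
      Finset.mul_sum]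
    have h4 : ∀ i, p i * (Real.exp (-t) * ∏ j ∈ S.erase i, (Real.exp (p j * t) - 1)) =
      Real.exp (-t) * (p i * ∏ j ∈ S.erase i, (Real.exp (p j * t) - 1)) := fun i => by ring
    simp only [h4]
    ring
  have hint : ∀ i, IntegrableOn (fun t => p i * F (S.erase i) t) (Set.Ioi 0) := fun i =>
    (integrableOn_exp_neg_mul_prod hp (hSe i)).const_mul _
  have hintS : IntegrableOn (fun t => (1 - ∑ i ∈ S, p i) * F S t) (Set.Ioi 0) :=
    (integrableOn_exp_neg_mul_prod hp hS).const_mul _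
  have hlim : Tendsto (F S) atTop (𝓝 0) := by
    have : Tendsto (fun t => Real.exp (-((1 - ∑ i ∈ S, p i) * t))) atTop (𝓝 0) :=
      Real.tendsto_exp_neg_atTop_nhds_zero.comp
        (tendsto_id.const_mul_atTop (sub_pos.2 hS))
    refine squeeze_zero' ?_ ?_ this
    · filter_upwards [eventually_ge_atTop 0] with t ht using exp_neg_mul_prod_nonneg hp S ht
    · filter_upwards [eventually_ge_atTop 0] with t ht using exp_neg_mul_prod_le hp S ht
  have hFTC := integral_Ioi_of_hasDerivAt_of_tendsto' (a := 0) (fun t _ => hderiv t)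
    ((integrable_finsetSum S fun i _ => hint i).sub hintS) hlim
  have h0 : F S 0 = 0 := by
    obtain ⟨i, hi⟩ := hne
    rw [hF]
    simp only [mul_zero, Real.exp_zero, sub_self]
    rw [Finset.prod_eq_zero hi rfl, mul_zero]
  rw [h0, sub_zero, integral_sub (integrable_finsetSum S fun i _ => hint i) hintS,
    integral_finsetSum S fun i _ => hint i, sub_eq_zero] at hFTC
  simp only [integral_const_mul] at hFTC
  exact hFTC.symm

/-- The expected time during which the set of values seen is `S`, when the draws are made at the
times of a Poisson process of unit rate: the number of draws of `i` up to time `t` is then Poisson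
with parameter `p i * t`, independently for all `i`. -/
theorem sum_seenTime_orderings (hp : ∀ i, 0 ≤ p i) {S : Finset ℕ} (hS : ∑ i ∈ S, p i < 1) :
    ∑ L ∈ orderings S, seenTime (fun i => ENNReal.ofReal (p i)) L =
      ENNReal.ofReal (∫ t in Set.Ioi 0, Real.exp (-t) * ∏ i ∈ S, (Real.exp (p i * t) - 1)) := by
  induction S using Finset.strongInduction with
  | H S ih =>
  rcases S.eq_empty_or_nonempty with rfl | hne
  · have : orderings ∅ = {[]} := by
      ext L
      simp only [mem_orderings, List.toFinset_eq_empty_iff, Finset.mem_singleton]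
      constructor
      · exact fun h => h.2
      · rintro rfl; simp
    simp [this, seenTime, integral_exp_Iic]
  have hpos : 0 < 1 - ∑ i ∈ S, p i := sub_pos.2 hS
  have hSe : ∀ i, ∑ j ∈ S.erase i, p j < 1 := fun i =>
    (Finset.sum_le_sum_of_subset_of_nonneg (Finset.erase_subset i S) fun j _ _ => hp j).trans_lt hS
  have hB : ∀ S : Finset ℕ,
      0 ≤ ∫ t in Set.Ioi 0, Real.exp (-t) * ∏ i ∈ S, (Real.exp (p i * t) - 1) := fun S =>
    setIntegral_nonneg measurableSet_Ioi fun t ht => exp_neg_mul_prod_nonneg hp S (le_of_lt ht)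
  have hsum : 1 - ∑ i ∈ S, ENNReal.ofReal (p i) = ENNReal.ofReal (1 - ∑ i ∈ S, p i) := by
    rw [← ENNReal.ofReal_sum_of_nonneg fun i _ => hp i,
      ENNReal.ofReal_sub _ (Finset.sum_nonneg fun i _ => hp i), ENNReal.ofReal_one]
  rw [sum_orderings hne]
  have hstep : ∀ i ∈ S, ∑ L ∈ orderings (S.erase i),
      seenTime (fun i => ENNReal.ofReal (p i)) (i :: L) =
      ENNReal.ofReal (p i * ∫ t in Set.Ioi 0, Real.exp (-t) *
        ∏ j ∈ S.erase i, (Real.exp (p j * t) - 1)) * (ENNReal.ofReal (1 - ∑ i ∈ S, p i))⁻¹ := by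
    intro i hi
    have h1 : ∀ L ∈ orderings (S.erase i), seenTime (fun i => ENNReal.ofReal (p i)) (i :: L) =
        seenTime (fun i => ENNReal.ofReal (p i)) L *
          (ENNReal.ofReal (p i) * (ENNReal.ofReal (1 - ∑ i ∈ S, p i))⁻¹) := by
      intro L hL
      rw [seenTime, List.map_cons, List.sum_cons, sum_map_of_mem_orderings hL,
        Finset.add_sum_erase S (fun i => ENNReal.ofReal (p i)) hi, hsum, mul_assoc]
    rw [Finset.sum_congr rfl h1, ← Finset.sum_mul, ih _ (Finset.erase_ssubset hi) (hSe i),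
      ENNReal.ofReal_mul (hp i)]
    ring
  rw [Finset.sum_congr rfl hstep, ← Finset.sum_mul,
    ← ENNReal.ofReal_sum_of_nonneg fun i _ => mul_nonneg (hp i) (hB _),
    ← integral_exp_neg_mul_prod_recursion hp hS hne, ENNReal.ofReal_mul hpos.le, mul_comm,
    ← mul_assoc, ENNReal.inv_mul_cancel (ENNReal.ofReal_pos.2 hpos).ne' ENNReal.ofReal_ne_top,
    one_mul]

end Poissonization

/-- The probability, given the weights, that at time `x` (measured in mean waiting times for the
first draw from outside the first `n` labels) each of the first `n` labels has been drawn. -/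
noncomputable def coverProb (n : ℕ) (w : ℕ → ℝ) (x : ℝ) : ℝ :=
  ∏ i ∈ Finset.range n,
    (1 - Real.exp (-(x * (stickBreaking w i / ∏ j ∈ Finset.range n, (1 - w j)))))

theorem coverProb_succ (n : ℕ) (w : ℕ → ℝ) (hw : ∀ i, w i ∈ Set.Ioo (0 : ℝ) 1) (x : ℝ) :
    coverProb (n + 1) w x =
      (1 - Real.exp (-(x * (w n / (1 - w n))))) * coverProb n w (x / (1 - w n)) := by
  rw [coverProb, Finset.prod_range_succ, mul_comm, coverProb]
  have h1 : (1 - w n) ≠ 0 := by linarith [(hw n).2]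
  have h2 := (residual_pos hw n).ne'
  congr 1
  · rw [stickBreaking, Finset.prod_range_succ]
    congr 4
    field_simp
  · refine Finset.prod_congr rfl fun i _ => ?_
    rw [Finset.prod_range_succ]
    congr 3
    field_simp

theorem coverProb_nonneg (n : ℕ) {w : ℕ → ℝ} (hw : ∀ i, w i ∈ Set.Ioo (0 : ℝ) 1) {x : ℝ}
    (hx : 0 ≤ x) : 0 ≤ coverProb n w x := by
  refine Finset.prod_nonneg fun i _ => sub_nonneg.2 (Real.exp_le_one_iff.2 (neg_nonpos.2 ?_))
  exact mul_nonneg hx (div_nonneg (stickBreaking_pos hw i).le (residual_pos hw n).le)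

theorem Measurable.coverProb {α : Type*} [MeasurableSpace α] (n : ℕ) {f : α → ℕ → ℝ} {g : α → ℝ}
    (hf : Measurable f) (hg : Measurable g) : Measurable fun a => coverProb n (f a) (g a) := by
  unfold _root_.coverProb stickBreaking
  fun_prop

theorem coverProb_truncate (n : ℕ) (w : ℕ → ℝ) (x : ℝ) :
    coverProb n (truncate n w) x = coverProb n w x := by
  refine Finset.prod_congr rfl fun i hi => ?_
  rw [stickBreaking_truncate (Finset.mem_range.1 hi)]
  congr 5
  refine Finset.prod_congr rfl fun j hj => ?_
  rw [truncate, if_pos (Finset.mem_range.1 hj)]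

theorem sum_listProb_orderings_range {w : ℕ → ℝ} (hw : ∀ i, w i ∈ Set.Ioo (0 : ℝ) 1) (n : ℕ) :
    ∑ L ∈ orderings (Finset.range n), listProb (stickWeight w) L =
      ∫⁻ x in Set.Ioi 0, ENNReal.ofReal (Real.exp (-x) * coverProb n w x) := by
  set R := ∏ j ∈ Finset.range n, (1 - w j) with hR
  have hR0 : 0 < R := residual_pos hw n
  have hp : ∀ i, 0 ≤ stickBreaking w i := fun i => (stickBreaking_pos hw i).le
  have hsum : ∑ i ∈ Finset.range n, stickBreaking w i < 1 := by
    rw [sum_stickBreaking]; linarith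
  have h1 : ∀ L ∈ orderings (Finset.range n), listProb (stickWeight w) L =
      seenTime (stickWeight w) L * ENNReal.ofReal R := fun L hL => by
    rw [listProb, sum_map_of_mem_orderings hL, one_sub_sum_stickWeight hw]
  rw [Finset.sum_congr rfl h1, ← Finset.sum_mul]
  have hint := integrableOn_exp_neg_mul_prod hp hsum
  have hcongr : ∀ t, Real.exp (-t) * ∏ i ∈ Finset.range n, (Real.exp (stickBreaking w i * t) - 1) =
      Real.exp (-(R * t)) * coverProb n w (R * t) := by
    intro t
    rw [exp_neg_mul_prod_eq, sum_stickBreaking, sub_sub_cancel, coverProb]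
    congr 1
    refine Finset.prod_congr rfl fun i _ => ?_
    congr 3
    rw [← hR]
    field_simp
  simp only [hcongr] at hint
  have hint' : IntegrableOn (fun x => Real.exp (-x) * coverProb n w x) (Set.Ioi 0) := by
    have := (integrableOn_Ioi_comp_mul_left_iff (fun x => Real.exp (-x) * coverProb n w x) 0
      hR0).1 hint
    rwa [mul_zero] at this
  have hsumt := sum_seenTime_orderings hp hsum
  simp only [hcongr] at hsumt
  change (∑ L ∈ orderings (Finset.range n),
    seenTime (fun i => ENNReal.ofReal (stickBreaking w i)) L) * _ = _
  rw [hsumt, integral_comp_mul_left_Ioi (fun x => Real.exp (-x) * coverProb n w x) 0 hR0, mul_zero,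
    smul_eq_mul, ENNReal.ofReal_mul (inv_pos.2 hR0).le, mul_right_comm,
    ← ENNReal.ofReal_mul (inv_pos.2 hR0).le, inv_mul_cancel₀ hR0.ne', ENNReal.ofReal_one, one_mul,
    ofReal_integral_eq_lintegral_ofReal hint']
  exact ae_restrict_of_forall_mem measurableSet_Ioi fun x hx =>
    mul_nonneg (Real.exp_pos _).le (coverProb_nonneg n hw (le_of_lt hx))

section Annealed

variable {Ω : Type*} [MeasurableSpace Ω] {μ : Measure Ω} [IsProbabilityMeasure μ]
  {P : Ω → ℕ → ℝ} {π : Ω → Equiv.Perm ℕ} {W : ℕ → Ω → ℝ} {ν : Measure ℝ}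

theorem measure_splitsAt (hm : ∀ i, Measurable (W i)) (hW : ∀ i ω, W i ω ∈ Set.Ioo (0 : ℝ) 1)
    (hP : Measurable P) (hPW : ∀ᵐ ω ∂μ, P ω = stickBreaking fun i => W i ω)
    (hπ : IsBiasedPermutation μ P π) (n : ℕ) :
    μ {ω | SplitsAt (π ω) n} = ∫⁻ x in Set.Ioi 0, ENNReal.ofReal (Real.exp (-x)) *
      ∫⁻ ω, ENNReal.ofReal (coverProb n (fun i => W i ω) x) ∂μ := by
  have hWm : Measurable fun ω i => W i ω := measurable_pi_lambda _ hm
  have h := (measure_firstValues_mem hW hP hPW hπ (n := n) subset_rfl).2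
  simp only [← splitsAt_iff] at h
  have h1 : ∀ L ∈ orderings (Finset.range n), μ {ω | firstValues (π ω) n = L} =
      ∫⁻ ω, listProb (stickWeight fun i => W i ω) L ∂μ := fun L hL =>
    (measure_firstValues_stickBreaking hW hP hPW hπ (mem_orderings.1 hL).1
      (by simpa using length_of_mem_orderings hL)).2
  have hF : ∀ L, Measurable fun ω => listProb (stickWeight fun i => W i ω) L := fun L =>
    ((measurable_listProb L).comp measurable_stickWeight).comp hWm
  have hc : Measurable fun z : Ω × ℝ => coverProb n (fun i => W i z.1) z.2 :=
    (hWm.comp measurable_fst).coverProb n measurable_snd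
  rw [h, Finset.sum_congr rfl h1, ← lintegral_finsetSum _ fun L _ => hF L,
    lintegral_congr fun ω => sum_listProb_orderings_range (fun i => hW i ω) n,
    lintegral_lintegral_swap]
  · refine lintegral_congr fun x => ?_
    rw [← lintegral_const_mul]
    · exact lintegral_congr fun ω => ENNReal.ofReal_mul (Real.exp_pos _).le
    · exact (hWm.coverProb n measurable_const).ennreal_ofReal
  · exact ((Real.measurable_exp.comp measurable_snd.neg).mul hc).ennreal_ofReal.aemeasurable

theorem lintegral_coverProb_succ (hm : ∀ i, Measurable (W i))
    (hW : ∀ i ω, W i ω ∈ Set.Ioo (0 : ℝ) 1) (hind : iIndepFun W μ) (hlaw : ∀ i, μ.map (W i) = ν)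
    (n : ℕ) {x : ℝ} (hx : 0 ≤ x) :
    ∫⁻ ω, ENNReal.ofReal (coverProb (n + 1) (fun i => W i ω) x) ∂μ =
      ∫⁻ a, ENNReal.ofReal (1 - Real.exp (-(x * (a / (1 - a))))) *
        ∫⁻ ω, ENNReal.ofReal (coverProb n (fun i => W i ω) (x / (1 - a))) ∂μ ∂ν := by
  have hWm : Measurable fun ω i => W i ω := measurable_pi_lambda _ hm
  have h1 : ∀ ω, ENNReal.ofReal (coverProb (n + 1) (fun i => W i ω) x) =
      ENNReal.ofReal (1 - Real.exp (-(x * (W (n + 0) ω / (1 - W (n + 0) ω))))) *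
        ENNReal.ofReal (coverProb n (truncate n fun i => W i ω) (x / (1 - W (n + 0) ω))) := by
    intro ω
    rw [coverProb_succ n _ (fun i => hW i ω), coverProb_truncate, ENNReal.ofReal_mul]
    · rfl
    · have := hW n ω
      refine sub_nonneg.2 (Real.exp_le_one_iff.2 (neg_nonpos.2 ?_))
      exact mul_nonneg hx (div_nonneg this.1.le (by linarith [this.2]))
  have hH : Measurable (Function.uncurry fun (v w : ℕ → ℝ) =>
      ENNReal.ofReal (1 - Real.exp (-(x * (w 0 / (1 - w 0))))) *
        ENNReal.ofReal (coverProb n v (x / (1 - w 0)))) := by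
    refine Measurable.mul (by fun_prop) (Measurable.ennreal_ofReal ?_)
    exact measurable_fst.coverProb n (by fun_prop)
  have hG : Measurable fun a =>
      ∫⁻ ω, ENNReal.ofReal (coverProb n (fun i => W i ω) (x / (1 - a))) ∂μ := by
    refine Measurable.lintegral_prod_right' (f := fun z : ℝ × Ω =>
      ENNReal.ofReal (coverProb n (fun i => W i z.2) (x / (1 - z.1))))
      (Measurable.ennreal_ofReal ?_)
    exact (hWm.comp measurable_snd).coverProb n (by fun_prop)
  rw [lintegral_congr h1, lintegral_truncate_shift hm hind hlaw n hH, ← hlaw 0,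
    lintegral_map _ (hm 0)]
  · refine lintegral_congr fun ω => ?_
    simp only [coverProb_truncate]
    rw [lintegral_const_mul]
    exact (hWm.coverProb n measurable_const).ennreal_ofReal
  · exact Measurable.mul (by fun_prop) hG

end Annealed

/-! ### Integrals of nonnegative functions -/

theorem lintegral_Ioo_deriv {f f' : ℝ → ℝ} {a b : ℝ} (hab : a ≤ b)
    (hc : ContinuousOn f (Set.Icc a b)) (hd : ∀ x ∈ Set.Ioo a b, HasDerivAt f (f' x) x)
    (hn : ∀ x ∈ Set.Ioo a b, 0 ≤ f' x) :
    ∫⁻ x in Set.Ioo a b, ENNReal.ofReal (f' x) = ENNReal.ofReal (f b - f a) := by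
  have hint := intervalIntegral.integrableOn_deriv_of_nonneg hc hd hn
  have h := intervalIntegral.integral_eq_sub_of_hasDerivAt_of_le hab hc hd
    ((intervalIntegrable_iff_integrableOn_Ioc_of_le hab).2 hint)
  rw [intervalIntegral.integral_of_le hab, integral_Ioc_eq_integral_Ioo] at h
  rw [← h, ofReal_integral_eq_lintegral_ofReal (hint.mono_set Set.Ioo_subset_Ioc_self)]
  exact ae_restrict_of_forall_mem measurableSet_Ioo hn

theorem lintegral_rpow_mul_exp {a b : ℝ} (ha : 0 < a) (hb : 0 < b) :
    ∫⁻ x in Set.Ioi 0, ENNReal.ofReal (x ^ (a - 1) * Real.exp (-(b * x))) =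
      ENNReal.ofReal (Real.Gamma a / b ^ a) := by
  have h := Real.integral_rpow_mul_exp_neg_mul_Ioi ha hb
  have hpos : 0 < (1 / b) ^ a * Real.Gamma a :=
    mul_pos (Real.rpow_pos_of_pos (by positivity) _) (Real.Gamma_pos_of_pos ha)
  rw [← ofReal_integral_eq_lintegral_ofReal, h]
  · congr 1
    rw [Real.div_rpow zero_le_one hb.le, Real.one_rpow]
    ring
  · exact Integrable.of_integral_ne_zero (h ▸ hpos.ne')
  · refine ae_restrict_of_forall_mem measurableSet_Ioi fun x hx => ?_
    exact mul_nonneg (Real.rpow_nonneg (le_of_lt hx) _) (Real.exp_pos _).le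

theorem lintegral_rpow_mul_one_add_rpow {a b : ℝ} (ha : 0 < a) (hb : 0 < b) :
    ∫⁻ r in Set.Ioi 0, ENNReal.ofReal (r ^ (a - 1) * (1 + r) ^ (-(a + b))) =
      ENNReal.ofReal (Real.Gamma a * Real.Gamma b / Real.Gamma (a + b)) := by
  have hG := Real.Gamma_pos_of_pos (add_pos ha hb)
  -- `(1 + r) ^ (-(a + b))` is a Laplace transform; exchange the two integrals
  have h1 : ∀ r ∈ Set.Ioi (0 : ℝ), ENNReal.ofReal (r ^ (a - 1) * (1 + r) ^ (-(a + b))) =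
      ∫⁻ x in Set.Ioi 0, ENNReal.ofReal (1 / Real.Gamma (a + b)) * (ENNReal.ofReal (r ^ (a - 1)) *
        ENNReal.ofReal (x ^ (a + b - 1) * Real.exp (-((1 + r) * x)))) := by
    intro r hr
    have hr : 0 < r := hr
    rw [lintegral_const_mul' _ _ ENNReal.ofReal_ne_top,
      lintegral_const_mul' _ _ ENNReal.ofReal_ne_top,
      lintegral_rpow_mul_exp (add_pos ha hb) (by positivity),
      ← ENNReal.ofReal_mul (by positivity), ← ENNReal.ofReal_mul (by positivity),
      Real.rpow_neg (by positivity)]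
    congr 1
    field_simp
  have h2 : ∀ x ∈ Set.Ioi (0 : ℝ), ∫⁻ r in Set.Ioi 0, ENNReal.ofReal (1 / Real.Gamma (a + b)) *
        (ENNReal.ofReal (r ^ (a - 1)) *
        ENNReal.ofReal (x ^ (a + b - 1) * Real.exp (-((1 + r) * x)))) =
      ENNReal.ofReal (Real.Gamma a / Real.Gamma (a + b)) *
        ENNReal.ofReal (x ^ (b - 1) * Real.exp (-(1 * x))) := by
    intro x hx
    have hx : 0 < x := hx
    have : ∀ r ∈ Set.Ioi (0 : ℝ), ENNReal.ofReal (1 / Real.Gamma (a + b)) *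
        (ENNReal.ofReal (r ^ (a - 1)) *
        ENNReal.ofReal (x ^ (a + b - 1) * Real.exp (-((1 + r) * x)))) =
        ENNReal.ofReal (1 / Real.Gamma (a + b) * (x ^ (a + b - 1) * Real.exp (-(1 * x)))) *
          ENNReal.ofReal (r ^ (a - 1) * Real.exp (-(x * r))) := by
      intro r hr
      have hr : 0 < r := hr
      rw [← ENNReal.ofReal_mul (by positivity), ← ENNReal.ofReal_mul (by positivity),
        ← ENNReal.ofReal_mul (by positivity)]
      congr 1
      rw [show -((1 + r) * x) = -(1 * x) + -(x * r) by ring, Real.exp_add]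
      ring
    rw [setLIntegral_congr_fun measurableSet_Ioi this,
      lintegral_const_mul' _ _ ENNReal.ofReal_ne_top, lintegral_rpow_mul_exp ha hx,
      ← ENNReal.ofReal_mul (by positivity), ← ENNReal.ofReal_mul (by positivity)]
    congr 1
    have : x ^ (a + b - 1) = x ^ a * x ^ (b - 1) := by
      rw [← Real.rpow_add hx]; congr 1; ring
    rw [this]
    field_simp
  rw [setLIntegral_congr_fun measurableSet_Ioi h1, lintegral_lintegral_swap,
    setLIntegral_congr_fun measurableSet_Ioi h2, lintegral_const_mul' _ _ ENNReal.ofReal_ne_top,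
    lintegral_rpow_mul_exp hb one_pos, ← ENNReal.ofReal_mul (by positivity)]
  · congr 1
    rw [Real.one_rpow]
    ring
  · exact Measurable.aemeasurable (by unfold Function.uncurry; fun_prop)

theorem lintegral_mul_lintegral_Ioi_swap {f g : ℝ → ℝ≥0∞} (hf : Measurable f) (hg : Measurable g) :
    ∫⁻ z in Set.Ioi 0, f z * ∫⁻ ρ in Set.Ioi z, g ρ =
      ∫⁻ ρ in Set.Ioi 0, g ρ * ∫⁻ z in Set.Ioo 0 ρ, f z := by
  have h1 : ∀ z ∈ Set.Ioi (0 : ℝ), f z * ∫⁻ ρ in Set.Ioi z, g ρ =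
      ∫⁻ ρ in Set.Ioi 0, {p : ℝ × ℝ | p.1 < p.2}.indicator (fun p => f p.1 * g p.2) (z, ρ) := by
    intro z hz
    rw [← lintegral_const_mul _ hg, ← lintegral_indicator measurableSet_Ioi,
      ← lintegral_indicator measurableSet_Ioi]
    refine lintegral_congr fun ρ => ?_
    have hz : 0 < z := hz
    by_cases hρ : z < ρ
    · simp [Set.indicator, hρ, hz.trans hρ]
    · simp [Set.indicator, hρ]
  have h2 : ∀ ρ ∈ Set.Ioi (0 : ℝ), g ρ * ∫⁻ z in Set.Ioo 0 ρ, f z =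
      ∫⁻ z in Set.Ioi 0, {p : ℝ × ℝ | p.1 < p.2}.indicator (fun p => f p.1 * g p.2) (z, ρ) := by
    intro ρ hρ
    rw [← lintegral_const_mul _ hf, ← lintegral_indicator measurableSet_Ioo,
      ← lintegral_indicator measurableSet_Ioi]
    refine lintegral_congr fun z => ?_
    by_cases hz : 0 < z
    · by_cases hρ : z < ρ
      · simp [Set.indicator, hρ, hz, mul_comm]
      · simp [Set.indicator, hρ]
    · simp [Set.indicator, hz]
  rw [setLIntegral_congr_fun measurableSet_Ioi h1, setLIntegral_congr_fun measurableSet_Ioi h2,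
    lintegral_lintegral_swap]
  refine Measurable.aemeasurable (Measurable.indicator ?_ ?_)
  · exact (hf.comp measurable_fst).mul (hg.comp measurable_snd)
  · exact measurableSet_lt measurable_fst measurable_snd

theorem lintegral_Ioo_scale {f : ℝ → ℝ≥0∞} {ρ : ℝ} (hρ : 0 < ρ) :
    ∫⁻ z in Set.Ioo 0 ρ, f z = ENNReal.ofReal ρ * ∫⁻ y in Set.Ioo 0 1, f (ρ * y) := by
  have himg : (fun y => ρ * y) '' Set.Ioo 0 1 = Set.Ioo 0 ρ := by
    rw [Set.image_mul_left_Ioo hρ, mul_zero, mul_one]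
  rw [← himg, lintegral_image_eq_lintegral_abs_deriv_mul measurableSet_Ioo
    (f' := fun _ => ρ) (fun y _ => by simpa using ((hasDerivAt_id y).const_mul ρ).hasDerivWithinAt)
    (fun a _ b _ h => mul_left_cancel₀ hρ.ne' h), ← lintegral_const_mul' _ _ ENNReal.ofReal_ne_top,
    abs_of_pos hρ]

theorem lintegral_exp_neg_div {x z : ℝ} (hz : 0 < z) :
    ∫⁻ y in Set.Ioo 0 1, ENNReal.ofReal (Real.exp (-(x * z / y)) / y) =
      ∫⁻ ρ in Set.Ioi z, ENNReal.ofReal (Real.exp (-(x * ρ)) / ρ) := by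
  have himg : (fun y => z / y) '' Set.Ioo 0 1 = Set.Ioi z := by
    ext ρ
    simp only [Set.mem_image, Set.mem_Ioo, Set.mem_Ioi]
    constructor
    · rintro ⟨y, ⟨h0, h1⟩, rfl⟩
      rw [lt_div_iff₀ h0]
      nlinarith
    · intro h
      have hρ := hz.trans h
      exact ⟨z / ρ, ⟨by positivity, (div_lt_one hρ).2 h⟩, by field_simp⟩
  rw [← himg, lintegral_image_eq_lintegral_abs_deriv_mul measurableSet_Ioo
    (f' := fun y => -(z / y ^ 2)) (fun y hy => ?_) (fun a ha b hb h => ?_)]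
  · refine setLIntegral_congr_fun measurableSet_Ioo fun y hy => ?_
    have hy0 : 0 < y := hy.1
    rw [abs_neg, abs_of_pos (by positivity), ← ENNReal.ofReal_mul (by positivity)]
    congr 1
    rw [mul_div_assoc]
    field_simp
  · have := (hasDerivAt_inv hy.1.ne').const_mul z
    refine (this.congr_deriv ?_).hasDerivWithinAt
    have := hy.1.ne'
    field_simp
  · have ha' := ha.1.ne'
    have hb' := hb.1.ne'
    field_simp at h
    nlinarith [h]

/-- The substitutions `ρ = z / y` and `ρ + 1 = (z + 1) / y` in the two terms of the integrand. -/
theorem lintegral_one_sub_exp_mul_exp_neg_div {x z : ℝ} (hx : 0 < x) (hz : 0 < z) :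
    ∫⁻ y in Set.Ioo 0 1, ENNReal.ofReal
        ((1 - Real.exp (-(x * ((1 - y) / y)))) * (Real.exp (-(x * z / y)) / y)) =
      ∫⁻ ρ in Set.Ioi z, ENNReal.ofReal (Real.exp (-(x * ρ)) / (ρ * (1 + ρ))) := by
  set I := ∫⁻ ρ in Set.Ioi z, ENNReal.ofReal (Real.exp (-(x * ρ)) / (1 + ρ)) with hI
  have hfin : I ≠ ∞ := by
    refine ne_top_of_le_ne_top (ENNReal.ofReal_ne_top (r := Real.Gamma 1 / x ^ (1 : ℝ))) ?_
    rw [← lintegral_rpow_mul_exp one_pos hx]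
    refine (lintegral_mono_set (Set.Ioi_subset_Ioi hz.le)).trans ?_
    refine setLIntegral_mono' measurableSet_Ioi fun ρ hρ => ENNReal.ofReal_le_ofReal ?_
    have hρ : 0 < ρ := hρ
    rw [sub_self, Real.rpow_zero, one_mul]
    exact div_le_self (Real.exp_pos _).le (by linarith)
  have hshift : I = ENNReal.ofReal (Real.exp x) *
      ∫⁻ y in Set.Ioo 0 1, ENNReal.ofReal (Real.exp (-(x * (z + 1) / y)) / y) := by
    have himg : (fun ρ => ρ + 1) '' Set.Ioi z = Set.Ioi (z + 1) := Set.image_add_const_Ioi _ _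
    rw [lintegral_exp_neg_div (by positivity), ← himg,
      lintegral_image_eq_lintegral_abs_deriv_mul measurableSet_Ioi (f' := fun _ => 1)
      (f := fun ρ => ρ + 1) (fun y _ => ((hasDerivAt_id y).add_const 1).hasDerivWithinAt)
      (fun a _ b _ h => add_right_cancel h), ← lintegral_const_mul' _ _ ENNReal.ofReal_ne_top]
    refine setLIntegral_congr_fun measurableSet_Ioi fun ρ hρ => ?_
    have hρ : 0 < ρ := hz.trans hρ
    rw [abs_one, ENNReal.ofReal_one, one_mul, ← ENNReal.ofReal_mul (Real.exp_pos _).le,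
      ← mul_div_assoc, ← Real.exp_add, add_comm ρ 1]
    congr 3
    ring
  rw [← ENNReal.add_left_inj hfin]
  trans ∫⁻ ρ in Set.Ioi z, ENNReal.ofReal (Real.exp (-(x * ρ)) / ρ)
  · rw [hshift, ← lintegral_const_mul' _ _ ENNReal.ofReal_ne_top,
      ← lintegral_add_right _ (by fun_prop),
      ← lintegral_exp_neg_div hz]
    refine setLIntegral_congr_fun measurableSet_Ioo fun y hy => ?_
    have hy0 : 0 < y := hy.1
    have hy1 : y < 1 := hy.2
    rw [← ENNReal.ofReal_mul (Real.exp_pos _).le, ← ENNReal.ofReal_add]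
    · congr 1
      have : Real.exp x * Real.exp (-(x * (z + 1) / y)) =
          Real.exp (-(x * ((1 - y) / y))) * Real.exp (-(x * z / y)) := by
        rw [← Real.exp_add, ← Real.exp_add]
        congr 1
        field_simp
        ring
      rw [← mul_div_assoc (Real.exp x), this]
      ring
    · refine mul_nonneg (sub_nonneg.2 (Real.exp_le_one_iff.2 (neg_nonpos.2 ?_))) (by positivity)
      exact mul_nonneg hx.le (div_nonneg (by linarith) hy0.le)
    · positivity
  · rw [hI, ← lintegral_add_right _ (by fun_prop)]
    refine setLIntegral_congr_fun measurableSet_Ioi fun ρ hρ => ?_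
    have hρ : 0 < ρ := hz.trans hρ
    rw [← ENNReal.ofReal_add (by positivity) (by positivity)]
    congr 1
    field_simp

theorem lintegral_betaMeasure_one {θ : ℝ} (hθ : 0 < θ) (f : ℝ → ℝ≥0∞) :
    ∫⁻ a, f a ∂(betaMeasure 1 θ) =
      ∫⁻ y in Set.Ioo 0 1, ENNReal.ofReal (θ * y ^ (θ - 1)) * f (1 - y) := by
  have hbeta : beta 1 θ = 1 / θ := by
    rw [beta, Real.Gamma_one, one_mul, add_comm, Real.Gamma_add_one hθ.ne']
    have := (Real.Gamma_pos_of_pos hθ).ne'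
    field_simp
  have hmeas : Measurable (betaPDF 1 θ) := (measurable_betaPDFReal 1 θ).ennreal_ofReal
  rw [betaMeasure, lintegral_withDensity_eq_lintegral_mul_non_measurable _
    hmeas (ae_of_all _ fun a => ENNReal.ofReal_lt_top),
    ← lintegral_sub_left_eq_self _ 1, ← lintegral_indicator measurableSet_Ioo]
  refine lintegral_congr fun y => ?_
  rw [Pi.mul_apply, betaPDF_eq]
  by_cases hy : y ∈ Set.Ioo (0 : ℝ) 1
  · rw [Set.indicator_of_mem hy, if_pos ⟨by linarith [hy.2], by linarith [hy.1]⟩, hbeta]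
    simp
  · rw [Set.indicator_of_notMem hy, if_neg, ENNReal.ofReal_zero, zero_mul]
    exact fun h => hy ⟨by linarith [h.2], by linarith [h.1]⟩

/-! ### The splitting probability as an integral, and its limit -/

/-- The expectation of `∏ j < n, 1 / (1 + r * R j)`, where `R j = Y 1 * ⋯ * Y j` and the factors
`Y i` are independent with the beta`(θ, 1)` distribution. -/
noncomputable def damping (θ : ℝ) : ℕ → ℝ → ℝ≥0∞
  | 0, _ => 1
  | n + 1, r => ENNReal.ofReal (1 + r)⁻¹ *
      ∫⁻ y in Set.Ioo 0 1, ENNReal.ofReal (θ * y ^ (θ - 1)) * damping θ n (r * y)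

theorem measurable_damping (θ : ℝ) (n : ℕ) : Measurable (damping θ n) := by
  induction n with
  | zero => exact measurable_const
  | succ n ih =>
    have h : Measurable fun z : ℝ × ℝ =>
        ENNReal.ofReal (θ * z.2 ^ (θ - 1)) * damping θ n (z.1 * z.2) :=
      Measurable.mul (by fun_prop) (ih.comp (by fun_prop))
    exact Measurable.mul (by fun_prop) h.lintegral_prod_right'

/-- The one-step operator of the chain which multiplies its state by `1 / (1 - W)`, damped by the
probability of covering the next label, acts on Laplace transforms through the recursion that
defines `damping`. -/
theorem lintegral_laplace_step {θ : ℝ} (hθ : 0 < θ) {k : ℝ → ℝ≥0∞} (hk : Measurable k) {x : ℝ}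
    (hx : 0 < x) :
    ∫⁻ y in Set.Ioo 0 1, ENNReal.ofReal (θ * y ^ (θ - 1)) *
        (ENNReal.ofReal (1 - Real.exp (-(x * ((1 - y) / y)))) *
          (ENNReal.ofReal ((x / y) ^ θ / Real.Gamma θ) *
            ∫⁻ r in Set.Ioi 0, ENNReal.ofReal (r ^ (θ - 1) * Real.exp (-(x / y * r))) * k r)) =
      ENNReal.ofReal (x ^ θ / Real.Gamma θ) *
        ∫⁻ r in Set.Ioi 0, ENNReal.ofReal (r ^ (θ - 1) * Real.exp (-(x * r))) *
          (ENNReal.ofReal (1 + r)⁻¹ *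
            ∫⁻ y in Set.Ioo 0 1, ENNReal.ofReal (θ * y ^ (θ - 1)) * k (r * y)) := by
  have hG := Real.Gamma_pos_of_pos hθ
  set f : ℝ → ℝ≥0∞ := fun z => ENNReal.ofReal (z ^ (θ - 1)) * k z with hf
  have hfm : Measurable f := Measurable.mul (by fun_prop) hk
  set h : ℝ → ℝ → ℝ := fun y z =>
    (1 - Real.exp (-(x * ((1 - y) / y)))) * (Real.exp (-(x * z / y)) / y) with hh
  have hA : ∀ y ∈ Set.Ioo (0 : ℝ) 1, ENNReal.ofReal (θ * y ^ (θ - 1)) *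
        (ENNReal.ofReal (1 - Real.exp (-(x * ((1 - y) / y)))) *
          (ENNReal.ofReal ((x / y) ^ θ / Real.Gamma θ) *
            ∫⁻ r in Set.Ioi 0, ENNReal.ofReal (r ^ (θ - 1) * Real.exp (-(x / y * r))) * k r)) =
      ∫⁻ z in Set.Ioi 0, ENNReal.ofReal (θ * (x ^ θ / Real.Gamma θ)) *
        (f z * ENNReal.ofReal (h y z)) := by
    intro y hy
    have hy0 : 0 < y := hy.1
    have hE : 0 ≤ 1 - Real.exp (-(x * ((1 - y) / y))) :=
      sub_nonneg.2 (Real.exp_le_one_iff.2 (neg_nonpos.2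
        (mul_nonneg hx.le (div_nonneg (by linarith [hy.2]) hy0.le))))
    rw [← lintegral_const_mul' _ _ ENNReal.ofReal_ne_top,
      ← lintegral_const_mul' _ _ ENNReal.ofReal_ne_top,
      ← lintegral_const_mul' _ _ ENNReal.ofReal_ne_top]
    refine setLIntegral_congr_fun measurableSet_Ioi fun z hz => ?_
    have hz : 0 < z := hz
    simp only [hf, ← mul_assoc]
    rw [← ENNReal.ofReal_mul (by positivity), ← ENNReal.ofReal_mul (by positivity),
      ← ENNReal.ofReal_mul (by positivity), ← ENNReal.ofReal_mul (by positivity),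
      mul_right_comm _ (k z), ← ENNReal.ofReal_mul (by positivity)]
    congr 2
    rw [hh, Real.div_rpow hx.le hy0.le, Real.rpow_sub_one hy0.ne',
      show x / y * z = x * z / y by ring]
    field_simp
  have hB : ∀ z ∈ Set.Ioi (0 : ℝ), ∫⁻ y in Set.Ioo 0 1,
      ENNReal.ofReal (θ * (x ^ θ / Real.Gamma θ)) * (f z * ENNReal.ofReal (h y z)) =
      ENNReal.ofReal (θ * (x ^ θ / Real.Gamma θ)) *
        (f z * ∫⁻ ρ in Set.Ioi z, ENNReal.ofReal (Real.exp (-(x * ρ)) / (ρ * (1 + ρ)))) := by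
    intro z hz
    rw [lintegral_const_mul' _ _ ENNReal.ofReal_ne_top, lintegral_const_mul _ (by fun_prop),
      ← lintegral_one_sub_exp_mul_exp_neg_div hx hz]
  rw [setLIntegral_congr_fun measurableSet_Ioo hA, lintegral_lintegral_swap,
    setLIntegral_congr_fun measurableSet_Ioi hB, lintegral_const_mul' _ _ ENNReal.ofReal_ne_top,
    lintegral_mul_lintegral_Ioi_swap hfm (by fun_prop), mul_comm θ,
    ENNReal.ofReal_mul (by positivity),
    mul_assoc, ← lintegral_const_mul' _ _ ENNReal.ofReal_ne_top]
  · congr 1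
    refine setLIntegral_congr_fun measurableSet_Ioi fun ρ hρ => ?_
    have hρ : 0 < ρ := hρ
    set J := ∫⁻ y in Set.Ioo 0 1, ENNReal.ofReal (y ^ (θ - 1)) * k (ρ * y) with hJ
    have h1 : ∫⁻ y in Set.Ioo 0 1, f (ρ * y) = ENNReal.ofReal (ρ ^ (θ - 1)) * J := by
      rw [hJ, ← lintegral_const_mul' _ _ ENNReal.ofReal_ne_top]
      refine setLIntegral_congr_fun measurableSet_Ioo fun y hy => ?_
      simp only [hf]
      rw [← mul_assoc, ← ENNReal.ofReal_mul (by positivity), Real.mul_rpow hρ.le hy.1.le]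
    have h2 : ∫⁻ y in Set.Ioo 0 1, ENNReal.ofReal (θ * y ^ (θ - 1)) * k (ρ * y) =
        ENNReal.ofReal θ * J := by
      rw [hJ, ← lintegral_const_mul' _ _ ENNReal.ofReal_ne_top]
      refine lintegral_congr fun y => ?_
      rw [ENNReal.ofReal_mul hθ.le, mul_assoc]
    rw [lintegral_Ioo_scale hρ, h1, h2]
    simp only [← mul_assoc]
    rw [← ENNReal.ofReal_mul (by positivity), ← ENNReal.ofReal_mul (by positivity),
      ← ENNReal.ofReal_mul (by positivity), ← ENNReal.ofReal_mul (by positivity),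
      ← ENNReal.ofReal_mul (by positivity)]
    congr 2
    field_simp
  · refine Measurable.aemeasurable (Measurable.mul measurable_const (Measurable.mul
      (hfm.comp measurable_snd) (Measurable.ennreal_ofReal ?_)))
    simp only [hh]
    fun_prop

section Law

variable {Ω : Type*} [MeasurableSpace Ω] {μ : Measure Ω} [IsProbabilityMeasure μ]
  {P : Ω → ℕ → ℝ} {π : Ω → Equiv.Perm ℕ} {W : ℕ → Ω → ℝ} {θ : ℝ}

theorem lintegral_coverProb (hθ : 0 < θ) (hm : ∀ i, Measurable (W i))
    (hW : ∀ i ω, W i ω ∈ Set.Ioo (0 : ℝ) 1) (hind : iIndepFun W μ)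
    (hlaw : ∀ i, μ.map (W i) = betaMeasure 1 θ) (n : ℕ) {x : ℝ} (hx : 0 < x) :
    ∫⁻ ω, ENNReal.ofReal (coverProb n (fun i => W i ω) x) ∂μ =
      ENNReal.ofReal (x ^ θ / Real.Gamma θ) *
        ∫⁻ r in Set.Ioi 0, ENNReal.ofReal (r ^ (θ - 1) * Real.exp (-(x * r))) * damping θ n r := by
  induction n generalizing x with
  | zero =>
    have hG := Real.Gamma_pos_of_pos hθ
    simp only [coverProb, damping, mul_one, Finset.range_zero, Finset.prod_empty]
    rw [lintegral_rpow_mul_exp hθ hx, ← ENNReal.ofReal_mul (by positivity)]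
    have : x ^ θ / Real.Gamma θ * (Real.Gamma θ / x ^ θ) = 1 := by
      have := Real.rpow_pos_of_pos hx θ
      field_simp
    simp [this]
  | succ n ih =>
    rw [lintegral_coverProb_succ hm hW hind hlaw n hx.le, lintegral_betaMeasure_one hθ]
    simp only [sub_sub_cancel, damping]
    rw [← lintegral_laplace_step hθ (measurable_damping θ n) hx]
    refine setLIntegral_congr_fun measurableSet_Ioo fun y hy => ?_
    rw [ih (div_pos hx hy.1)]

theorem measure_splitsAt_eq_lintegral_damping (hθ : 0 < θ) (hm : ∀ i, Measurable (W i))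
    (hW : ∀ i ω, W i ω ∈ Set.Ioo (0 : ℝ) 1) (hind : iIndepFun W μ)
    (hlaw : ∀ i, μ.map (W i) = betaMeasure 1 θ) (hP : Measurable P)
    (hPW : ∀ᵐ ω ∂μ, P ω = stickBreaking fun i => W i ω) (hπ : IsBiasedPermutation μ P π) (n : ℕ) :
    μ {ω | SplitsAt (π ω) n} =
      ∫⁻ r in Set.Ioi 0, ENNReal.ofReal (θ * (r ^ (θ - 1) * (1 + r) ^ (-(θ + 1)))) *
        damping θ n r := by
  have hG := Real.Gamma_pos_of_pos hθ
  have hk := measurable_damping θ n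
  have h1 : ∀ x ∈ Set.Ioi (0 : ℝ), ENNReal.ofReal (Real.exp (-x)) *
      ∫⁻ ω, ENNReal.ofReal (coverProb n (fun i => W i ω) x) ∂μ =
      ∫⁻ r in Set.Ioi 0, ENNReal.ofReal (x ^ (θ + 1 - 1) * Real.exp (-((1 + r) * x))) *
        (ENNReal.ofReal (r ^ (θ - 1) / Real.Gamma θ) * damping θ n r) := by
    intro x hx
    have hx : 0 < x := hx
    rw [lintegral_coverProb hθ hm hW hind hlaw n hx,
      ← lintegral_const_mul' _ _ ENNReal.ofReal_ne_top,
      ← lintegral_const_mul' _ _ ENNReal.ofReal_ne_top]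
    refine setLIntegral_congr_fun measurableSet_Ioi fun r hr => ?_
    have hr : 0 < r := hr
    simp only [← mul_assoc]
    rw [← ENNReal.ofReal_mul (by positivity), ← ENNReal.ofReal_mul (by positivity),
      ← ENNReal.ofReal_mul (by positivity)]
    congr 2
    rw [add_sub_cancel_right, show -((1 + r) * x) = -x + -(x * r) by ring, Real.exp_add]
    ring
  rw [measure_splitsAt hm hW hP hPW hπ, setLIntegral_congr_fun measurableSet_Ioi h1,
    lintegral_lintegral_swap]
  · refine setLIntegral_congr_fun measurableSet_Ioi fun r hr => ?_
    have hr : 0 < r := hr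
    rw [lintegral_mul_const _ (by fun_prop), lintegral_rpow_mul_exp (by positivity) (by positivity),
      ← mul_assoc, ← ENNReal.ofReal_mul (div_nonneg (Real.Gamma_pos_of_pos (by positivity)).le
        (by positivity)), Real.Gamma_add_one hθ.ne', Real.rpow_neg (by positivity)]
    congr 2
    field_simp
  · refine Measurable.aemeasurable (Measurable.mul (by fun_prop) (Measurable.mul (by fun_prop)
      (hk.comp measurable_snd)))

end Law

theorem lintegral_beta_density {θ : ℝ} (hθ : 0 < θ) :
    ∫⁻ y in Set.Ioo 0 1, ENNReal.ofReal (θ * y ^ (θ - 1)) = 1 := by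
  rw [lintegral_Ioo_deriv (f := fun y => y ^ θ) zero_le_one
    (Real.continuous_rpow_const hθ.le).continuousOn]
  · simp [Real.zero_rpow hθ.ne']
  · exact fun y hy => Real.hasDerivAt_rpow_const (Or.inl hy.1.ne')
  · exact fun y hy => mul_nonneg hθ.le (Real.rpow_nonneg hy.1.le _)

theorem lintegral_beta_density_mul_self {θ : ℝ} (hθ : 0 < θ) :
    ∫⁻ y in Set.Ioo 0 1, ENNReal.ofReal (θ * y ^ (θ - 1)) * ENNReal.ofReal y =
      ENNReal.ofReal (θ / (θ + 1)) := by
  have h : ∀ y ∈ Set.Ioo (0 : ℝ) 1, ENNReal.ofReal (θ * y ^ (θ - 1)) * ENNReal.ofReal y =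
      ENNReal.ofReal (θ / (θ + 1)) * ENNReal.ofReal ((θ + 1) * y ^ (θ + 1 - 1)) := by
    intro y hy
    have hy0 : 0 < y := hy.1
    rw [← ENNReal.ofReal_mul (by positivity), ← ENNReal.ofReal_mul (by positivity),
      add_sub_cancel_right, Real.rpow_sub_one hy0.ne']
    congr 1
    field_simp
  rw [setLIntegral_congr_fun measurableSet_Ioo h, lintegral_const_mul' _ _ ENNReal.ofReal_ne_top,
    lintegral_beta_density (by positivity), mul_one]

theorem lintegral_beta_density_mul_rpow {θ r : ℝ} (hθ : 0 < θ) (hr : 0 < r) :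
    ∫⁻ y in Set.Ioo 0 1, ENNReal.ofReal (θ * y ^ (θ - 1)) *
      ENNReal.ofReal ((1 + r * y) ^ (-(θ + 1))) = ENNReal.ofReal ((1 + r) ^ (-θ)) := by
  have h : ∀ y ∈ Set.Ioo (0 : ℝ) 1, ENNReal.ofReal (θ * y ^ (θ - 1)) *
      ENNReal.ofReal ((1 + r * y) ^ (-(θ + 1))) =
      ENNReal.ofReal (1 / (1 + r * y) ^ 2 * θ * (y / (1 + r * y)) ^ (θ - 1)) := by
    intro y hy
    have hy0 : 0 < y := hy.1
    have h1 : 0 < 1 + r * y := by positivity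
    rw [← ENNReal.ofReal_mul (by positivity), Real.div_rpow hy0.le h1.le,
      show -(θ + 1) = -(θ - 1) - (2 : ℕ) by push_cast; ring, Real.rpow_sub_natCast h1.ne',
      Real.rpow_neg h1.le]
    congr 1
    field_simp
  have hpos : ∀ y ∈ Set.Icc (0 : ℝ) 1, 0 < 1 + r * y := fun y hy => by
    have := mul_nonneg hr.le hy.1
    linarith
  rw [setLIntegral_congr_fun measurableSet_Ioo h,
    lintegral_Ioo_deriv (f := fun y => (y / (1 + r * y)) ^ θ) zero_le_one]
  · rw [zero_div, Real.zero_rpow hθ.ne', sub_zero, mul_one, Real.rpow_neg (by positivity),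
      Real.div_rpow zero_le_one (by positivity), Real.one_rpow, one_div]
  · refine ContinuousOn.rpow_const (ContinuousOn.div (by fun_prop) (by fun_prop)
      fun y hy => (hpos y hy).ne') fun y _ => Or.inr hθ.le
  · intro y hy
    have h1 := hpos y ⟨hy.1.le, hy.2.le⟩
    have h2 : HasDerivAt (fun y => y / (1 + r * y)) (1 / (1 + r * y) ^ 2) y := by
      refine ((hasDerivAt_id y).div (((hasDerivAt_id y).const_mul r).const_add 1)
        h1.ne').congr_deriv ?_
      simp only [id, one_mul, mul_one]
      ring
    exact h2.rpow_const (Or.inl (div_pos hy.1 h1).ne')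
  · intro y hy
    have h1 := hpos y ⟨hy.1.le, hy.2.le⟩
    have := hy.1
    positivity

theorem damping_le_one {θ : ℝ} (hθ : 0 < θ) (n : ℕ) {r : ℝ} (hr : 0 < r) : damping θ n r ≤ 1 := by
  induction n generalizing r with
  | zero => exact le_rfl
  | succ n ih =>
    refine mul_le_one' ?_ ?_
    · rw [ENNReal.ofReal_le_one]
      exact inv_le_one_of_one_le₀ (by linarith)
    · rw [← lintegral_beta_density hθ]
      refine setLIntegral_mono' measurableSet_Ioo fun y hy => ?_
      exact mul_le_of_le_one_right' (ih (mul_pos hr hy.1))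

theorem ofReal_inv_one_add_mul_rpow {θ r : ℝ} (hr : 0 < r) :
    ENNReal.ofReal (1 + r)⁻¹ * ENNReal.ofReal ((1 + r) ^ (-θ)) =
      ENNReal.ofReal ((1 + r) ^ (-(θ + 1))) := by
  have : 0 < 1 + r := by positivity
  rw [← ENNReal.ofReal_mul (by positivity), show -(θ + 1) = -1 + -θ by ring,
    Real.rpow_add this, Real.rpow_neg_one]

/-- The function `(1 + r) ^ (-(θ + 1))` is a fixed point of the recursion that defines `damping`,
and the recursion contracts the distance to it by the mean `θ / (θ + 1)` of a beta`(θ, 1)`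
variable. -/
theorem damping_bounds {θ : ℝ} (hθ : 0 < θ) (n : ℕ) {r : ℝ} (hr : 0 < r) :
    ENNReal.ofReal ((1 + r) ^ (-(θ + 1))) ≤ damping θ n r ∧
      damping θ n r ≤ ENNReal.ofReal ((1 + r) ^ (-(θ + 1))) +
        ENNReal.ofReal ((θ + 1) * (θ / (θ + 1)) ^ n) * ENNReal.ofReal r := by
  induction n generalizing r with
  | zero =>
    have h1 : (0 : ℝ) < 1 + r := by positivity
    constructor
    · rw [damping, ENNReal.ofReal_le_one]
      exact Real.rpow_le_one_of_one_le_of_nonpos (by linarith) (by linarith)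
    · rw [damping, pow_zero, mul_one, ← ENNReal.ofReal_mul (by positivity),
        ← ENNReal.ofReal_add (by positivity) (by positivity), ENNReal.one_le_ofReal,
        Real.rpow_def_of_pos h1]
      have h2 := Real.add_one_le_exp (Real.log (1 + r) * (-(θ + 1)))
      have h3 := Real.log_le_sub_one_of_pos h1
      nlinarith
  | succ n ih =>
    set c := ENNReal.ofReal ((θ + 1) * (θ / (θ + 1)) ^ n) with hc
    have hone : ENNReal.ofReal (1 + r)⁻¹ ≤ 1 := by
      rw [ENNReal.ofReal_le_one]
      exact inv_le_one_of_one_le₀ (by linarith)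
    rw [damping, ← ofReal_inv_one_add_mul_rpow hr, ← lintegral_beta_density_mul_rpow hθ hr]
    constructor
    · gcongr ENNReal.ofReal (1 + r)⁻¹ * ?_
      refine setLIntegral_mono' measurableSet_Ioo fun y hy => ?_
      gcongr
      exact (ih (mul_pos hr hy.1)).1
    · have h1 : ∫⁻ y in Set.Ioo 0 1, ENNReal.ofReal (θ * y ^ (θ - 1)) * damping θ n (r * y) ≤
          ∫⁻ y in Set.Ioo 0 1, (ENNReal.ofReal (θ * y ^ (θ - 1)) *
            ENNReal.ofReal ((1 + r * y) ^ (-(θ + 1))) + c * ENNReal.ofReal r *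
            (ENNReal.ofReal (θ * y ^ (θ - 1)) * ENNReal.ofReal y)) := by
        refine setLIntegral_mono' measurableSet_Ioo fun y hy => ?_
        refine (mul_le_mul_right (ih (mul_pos hr hy.1)).2 _).trans (le_of_eq ?_)
        rw [ENNReal.ofReal_mul hr.le]
        ring
      rw [lintegral_add_right _ (by fun_prop), lintegral_const_mul _ (by fun_prop),
        lintegral_beta_density_mul_self hθ] at h1
      refine (mul_le_mul_right h1 _).trans ?_
      rw [mul_add]
      refine add_le_add le_rfl ?_
      refine (mul_le_of_le_one_left' hone).trans (le_of_eq ?_)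
      rw [pow_succ, ← mul_assoc, ENNReal.ofReal_mul (by positivity), ← hc]
      ring

theorem tendsto_damping {θ : ℝ} (hθ : 0 < θ) {r : ℝ} (hr : 0 < r) :
    Tendsto (fun n => damping θ n r) atTop (𝓝 (ENNReal.ofReal ((1 + r) ^ (-(θ + 1))))) := by
  have h1 : Tendsto (fun n : ℕ => (θ + 1) * (θ / (θ + 1)) ^ n * r) atTop (𝓝 0) := by
    have := (tendsto_pow_atTop_nhds_zero_of_lt_one (r := θ / (θ + 1)) (by positivity)
      ((div_lt_one (by positivity)).2 (by linarith))).const_mul (θ + 1)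
    simpa using this.mul_const r
  have h2 := (ENNReal.tendsto_ofReal h1).const_add (ENNReal.ofReal ((1 + r) ^ (-(θ + 1))))
  rw [ENNReal.ofReal_zero, add_zero] at h2
  refine tendsto_of_tendsto_of_tendsto_of_le_of_le tendsto_const_nhds h2
    (fun n => (damping_bounds hθ n hr).1) fun n => ?_
  refine (damping_bounds hθ n hr).2.trans (le_of_eq ?_)
  rw [← ENNReal.ofReal_mul (by positivity)]

theorem tendsto_lintegral_damping {θ : ℝ} (hθ : 0 < θ) :
    Tendsto (fun n => ∫⁻ r in Set.Ioi 0,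
        ENNReal.ofReal (θ * (r ^ (θ - 1) * (1 + r) ^ (-(θ + 1)))) * damping θ n r) atTop
      (𝓝 (ENNReal.ofReal
        (Real.Gamma (θ + 2) * Real.Gamma (θ + 1) / Real.Gamma (2 * θ + 2)))) := by
  have hlim : ∫⁻ r in Set.Ioi 0, ENNReal.ofReal (θ * (r ^ (θ - 1) * (1 + r) ^ (-(θ + 1)))) *
      ENNReal.ofReal ((1 + r) ^ (-(θ + 1))) =
      ENNReal.ofReal (Real.Gamma (θ + 2) * Real.Gamma (θ + 1) / Real.Gamma (2 * θ + 2)) := by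
    have h : ∀ r ∈ Set.Ioi (0 : ℝ),
        ENNReal.ofReal (θ * (r ^ (θ - 1) * (1 + r) ^ (-(θ + 1)))) *
          ENNReal.ofReal ((1 + r) ^ (-(θ + 1))) =
        ENNReal.ofReal θ * ENNReal.ofReal (r ^ (θ - 1) * (1 + r) ^ (-(θ + (θ + 2)))) := by
      intro r hr
      have hr : 0 < r := hr
      rw [← ENNReal.ofReal_mul (by positivity), ← ENNReal.ofReal_mul (by positivity),
        show -(θ + (θ + 2)) = -(θ + 1) + -(θ + 1) by ring, Real.rpow_add (by positivity)]
      congr 1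
      ring
    rw [setLIntegral_congr_fun measurableSet_Ioi h, lintegral_const_mul' _ _ ENNReal.ofReal_ne_top,
      lintegral_rpow_mul_one_add_rpow hθ (by positivity), ← ENNReal.ofReal_mul hθ.le,
      Real.Gamma_add_one hθ.ne', show θ + (θ + 2) = 2 * θ + 2 by ring]
    congr 1
    ring
  rw [← hlim]
  refine tendsto_lintegral_of_dominated_convergence
    (fun r => ENNReal.ofReal (θ * (r ^ (θ - 1) * (1 + r) ^ (-(θ + 1)))))
    (fun n => Measurable.mul (by fun_prop) (measurable_damping θ n)) (fun n => ?_) ?_ ?_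
  · exact ae_restrict_of_forall_mem measurableSet_Ioi fun r hr =>
      mul_le_of_le_one_right' (damping_le_one hθ n hr)
  · have h : ∀ r ∈ Set.Ioi (0 : ℝ), ENNReal.ofReal (θ * (r ^ (θ - 1) * (1 + r) ^ (-(θ + 1)))) =
        ENNReal.ofReal θ * ENNReal.ofReal (r ^ (θ - 1) * (1 + r) ^ (-(θ + 1))) :=
      fun r _ => ENNReal.ofReal_mul hθ.le
    rw [setLIntegral_congr_fun measurableSet_Ioi h, lintegral_const_mul' _ _ ENNReal.ofReal_ne_top,
      lintegral_rpow_mul_one_add_rpow hθ one_pos]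
    exact ENNReal.mul_ne_top ENNReal.ofReal_ne_top ENNReal.ofReal_ne_top
  · exact ae_restrict_of_forall_mem measurableSet_Ioi fun r hr =>
      ENNReal.Tendsto.const_mul (tendsto_damping hθ hr) (Or.inr ENNReal.ofReal_ne_top)

/-! ### The infinite product -/

theorem multipliable_gamma_product {θ : ℝ} (hθ : 0 < θ) :
    Multipliable fun j : ℕ =>
      ((j : ℝ) + 2) * ((j : ℝ) + 2 + 2 * θ) / ((j : ℝ) + 2 + θ) ^ 2 := by
  have h : ∀ j : ℕ, ((j : ℝ) + 2) * ((j : ℝ) + 2 + 2 * θ) / ((j : ℝ) + 2 + θ) ^ 2 =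
      1 + -(θ ^ 2 / ((j : ℝ) + 2 + θ) ^ 2) := by
    intro j
    have : (0 : ℝ) < (j : ℝ) + 2 + θ := by positivity
    field_simp
    ring
  simp only [h]
  refine multipliable_one_add_of_summable ?_
  have hs := ((summable_nat_add_iff 2).2 (Real.summable_one_div_nat_pow.2 one_lt_two)).mul_left
    (θ ^ 2)
  refine Summable.of_nonneg_of_le (fun j => norm_nonneg _) (fun j => ?_) hs
  rw [norm_neg, Real.norm_of_nonneg (by positivity), mul_one_div]
  push_cast
  have : (0 : ℝ) ≤ j := j.cast_nonneg
  gcongr θ ^ 2 / ?_ ^ 2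
  linarith

/-- Euler's limit formula for the Gamma function, applied to the partial products. -/
theorem tprod_gamma_product {θ : ℝ} (hθ : 0 < θ) :
    ∏' j : ℕ, ((j : ℝ) + 2) * ((j : ℝ) + 2 + 2 * θ) / ((j : ℝ) + 2 + θ) ^ 2 =
      Real.Gamma (θ + 2) ^ 2 / Real.Gamma (2 * θ + 2) := by
  have h1 := (tendsto_add_atTop_iff_nat 1).2 (multipliable_gamma_product hθ).tendsto_prod_tprod_nat
  have h2 : Tendsto (fun n => Real.GammaSeq (θ + 2) n ^ 2 /
      (Real.GammaSeq 2 n * Real.GammaSeq (2 * θ + 2) n)) atTop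
      (𝓝 (Real.Gamma (θ + 2) ^ 2 / (Real.Gamma 2 * Real.Gamma (2 * θ + 2)))) := by
    refine ((Real.GammaSeq_tendsto_Gamma _).pow 2).div
      ((Real.GammaSeq_tendsto_Gamma _).mul (Real.GammaSeq_tendsto_Gamma _)) ?_
    exact (mul_pos (Real.Gamma_pos_of_pos two_pos) (Real.Gamma_pos_of_pos (by positivity))).ne'
  rw [Real.Gamma_two, one_mul] at h2
  refine tendsto_nhds_unique h1 (h2.congr' ?_)
  filter_upwards [eventually_gt_atTop 0] with n hn
  have hn : (0 : ℝ) < n := Nat.cast_pos.2 hn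
  have hpow : (n : ℝ) ^ (2 * θ + 2) * (n : ℝ) ^ (2 : ℝ) = ((n : ℝ) ^ (θ + 2)) ^ 2 := by
    rw [← Real.rpow_add hn, sq, ← Real.rpow_add hn]
    congr 1
    ring
  have hA : 0 < ∏ j ∈ Finset.range (n + 1), ((2 : ℝ) + j) :=
    Finset.prod_pos fun j _ => by positivity
  have hB : 0 < ∏ j ∈ Finset.range (n + 1), (2 * θ + 2 + j) :=
    Finset.prod_pos fun j _ => by positivity
  have hC : 0 < ∏ j ∈ Finset.range (n + 1), (θ + 2 + j) :=
    Finset.prod_pos fun j _ => by positivity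
  have hprod : ∏ j ∈ Finset.range (n + 1),
      ((j : ℝ) + 2) * ((j : ℝ) + 2 + 2 * θ) / ((j : ℝ) + 2 + θ) ^ 2 =
      (∏ j ∈ Finset.range (n + 1), ((2 : ℝ) + j)) * (∏ j ∈ Finset.range (n + 1), (2 * θ + 2 + j)) /
        (∏ j ∈ Finset.range (n + 1), (θ + 2 + j)) ^ 2 := by
    rw [← Finset.prod_mul_distrib, ← Finset.prod_pow, ← Finset.prod_div_distrib]
    refine Finset.prod_congr rfl fun j _ => ?_
    congr 1 <;> ring
  have hf : (0 : ℝ) < n.factorial := Nat.cast_pos.2 n.factorial_pos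
  have h3 := Real.rpow_pos_of_pos hn (2 * θ + 2)
  have h4 := Real.rpow_pos_of_pos hn 2
  rw [hprod, Real.GammaSeq, Real.GammaSeq, Real.GammaSeq, div_pow, mul_pow, ← hpow]
  generalize (n : ℝ) ^ (2 * θ + 2) = a at *
  generalize (n : ℝ) ^ (2 : ℝ) = b at *
  field_simp

/-! ### The renewal equation -/

/-- With `u n` the probability of a renewal at `n`, and `f` and `g` the point and tail probabilities
of the inter-renewal time: the `k`-th term is the probability that the last renewal up to time `n`
occurs at `n - k`. -/
theorem sum_mul_eq_one_of_renewal {f g u : ℕ → ℝ} (hu0 : u 0 = 1) (hg0 : g 0 = 1)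
    (hg : ∀ k, g k = g (k + 1) + f (k + 1))
    (hu : ∀ n, u (n + 1) = ∑ k ∈ Finset.range (n + 1), f (k + 1) * u (n - k)) (n : ℕ) :
    ∑ k ∈ Finset.range (n + 1), g k * u (n - k) = 1 := by
  induction n with
  | zero => simp [hu0, hg0]
  | succ n ih =>
    rw [Finset.sum_range_succ', hg0, one_mul, Nat.sub_zero, hu, ← Finset.sum_add_distrib, ← ih]
    refine Finset.sum_congr rfl fun k _ => ?_
    rw [hg k, Nat.add_sub_add_right]
    ring

/-- If the renewal probabilities have a positive limit, then the mean of the inter-renewal time,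
written as the sum of its tail probabilities `g`, is the inverse of that limit. -/
theorem hasSum_of_renewal {g u : ℕ → ℝ} {l : ℝ} (hg : ∀ k, 0 ≤ g k) (hu : ∀ n, 0 ≤ u n)
    (hu1 : ∀ n, u n ≤ 1) (hl : 0 < l) (hlim : Tendsto u atTop (𝓝 l))
    (h : ∀ n, ∑ k ∈ Finset.range (n + 1), g k * u (n - k) = 1) : HasSum g (1 / l) := by
  have hshift : ∀ k, Tendsto (fun n => u (n - k)) atTop (𝓝 l) := fun k =>
    hlim.comp (tendsto_sub_atTop_nat k)
  have hsum : Summable g := by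
    refine summable_of_sum_range_le (c := 1 / l) hg fun N => ?_
    rw [le_div_iff₀ hl, Finset.sum_mul]
    refine le_of_tendsto
      (tendsto_finsetSum (Finset.range N) fun k _ => (hshift k).const_mul (g k)) ?_
    filter_upwards [eventually_ge_atTop N] with n hn
    rw [← h n]
    exact Finset.sum_le_sum_of_subset_of_nonneg (Finset.range_subset_range.2 (by omega))
      fun k _ _ => mul_nonneg (hg k) (hu _)
  have hdom := tendsto_tsum_of_dominated_convergence (𝓕 := atTop)
    (f := fun n k => if k ∈ Finset.range (n + 1) then g k * u (n - k) else 0)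
    (g := fun k => g k * l) hsum (fun k => ?_) (.of_forall fun n k => ?_)
  · have h1 : ∀ n, ∑' k, (if k ∈ Finset.range (n + 1) then g k * u (n - k) else 0) = 1 := by
      intro n
      rw [← h n, tsum_eq_sum (s := Finset.range (n + 1)) fun k hk => if_neg hk]
      exact Finset.sum_congr rfl fun k hk => if_pos hk
    simp only [h1] at hdom
    have h2 := tendsto_nhds_unique hdom tendsto_const_nhds
    rw [tsum_mul_right] at h2
    rw [← eq_div_iff hl.ne'] at h2
    exact h2 ▸ hsum.hasSum
  · refine ((hshift k).const_mul (g k)).congr' ?_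
    filter_upwards [eventually_ge_atTop k] with n hn
    rw [if_pos (Finset.mem_range.2 (by omega))]
  · split_ifs
    · rw [Real.norm_of_nonneg (mul_nonneg (hg k) (hu _))]
      exact mul_le_of_le_one_right (hg k) (hu1 _)
    · simpa using hg k

theorem firstComponentLength_eq_tsum (σ : Equiv.Perm ℕ) :
    (firstComponentLength σ : ℝ≥0∞) =
      ∑' k : ℕ, {k : ℕ | ∀ j, 1 ≤ j → j ≤ k → ¬ SplitsAt σ j}.indicator 1 k := by
  classical
  by_cases h : ∃ n, 1 ≤ n ∧ SplitsAt σ n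
  · have hlen : firstComponentLength σ = (Nat.find h : ℕ) := by
      refine le_antisymm (iInf₂_le (Nat.find h) (Nat.find_spec h)) (le_iInf₂ fun n hn => ?_)
      exact Nat.cast_le.2 (Nat.find_min' h hn)
    have hset : {k : ℕ | ∀ j, 1 ≤ j → j ≤ k → ¬ SplitsAt σ j} =
        (Finset.range (Nat.find h) : Finset ℕ) := by
      ext k
      simp only [Set.mem_ofPred_eq, Finset.coe_range, Set.mem_Iio]
      constructor
      · intro hk
        by_contra! hle
        exact hk _ (Nat.find_spec h).1 hle (Nat.find_spec h).2
      · exact fun hk j h1 hj hs => Nat.find_min h (hj.trans_lt hk) ⟨h1, hs⟩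
    rw [hlen, hset, ENat.toENNReal_coe, tsum_eq_sum (s := Finset.range (Nat.find h))]
    · rw [Finset.sum_congr rfl fun k hk => Set.indicator_of_mem (Finset.mem_coe.2 hk) _]
      simp
    · exact fun k hk => Set.indicator_of_notMem (mt Finset.mem_coe.1 hk) _
  · push Not at h
    have hset : {k : ℕ | ∀ j, 1 ≤ j → j ≤ k → ¬ SplitsAt σ j} = Set.univ := by
      ext k
      simpa using fun j h1 _ => h j h1
    have hlen : firstComponentLength σ = ⊤ := by
      refine iInf₂_eq_top.2 fun n hn => absurd hn.2 (h n hn.1)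
    rw [hlen, hset, ENat.toENNReal_top]
    simp

section Length

variable {Ω : Type*} [MeasurableSpace Ω] {μ : Measure Ω} [IsProbabilityMeasure μ]
  {P : Ω → ℕ → ℝ} {π : Ω → Equiv.Perm ℕ} {W : ℕ → Ω → ℝ} {ν : Measure ℝ}

theorem renewalProb_succ (hm : ∀ i, Measurable (W i))
    (hW : ∀ i ω, W i ω ∈ Set.Ioo (0 : ℝ) 1) (hind : iIndepFun W μ) (hlaw : ∀ i, μ.map (W i) = ν)
    (hP : Measurable P) (hPW : ∀ᵐ ω ∂μ, P ω = stickBreaking fun i => W i ω)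
    (hπ : IsBiasedPermutation μ P π) (n : ℕ) :
    renewalProb μ π (n + 1) = ∑ k ∈ Finset.range (n + 1),
      μ.real {ω | FirstSplitsAt (π ω) (k + 1)} * renewalProb μ π (n - k) := by
  classical
  have he : {ω | SplitsAt (π ω) (n + 1)} = ⋃ k ∈ Finset.range (n + 1),
      {ω | FirstSplitsAt (π ω) (k + 1) ∧ SplitsAt (π ω) (k + 1 + (n - k))} := by
    ext ω
    simp only [Set.mem_ofPred_eq, Set.mem_iUnion, exists_prop, Finset.mem_range]
    constructor
    · intro h
      have hex : ∃ j, 1 ≤ j ∧ SplitsAt (π ω) j := ⟨n + 1, by omega, h⟩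
      obtain ⟨h1, h2⟩ := Nat.find_spec hex
      have h3 := Nat.find_min' hex ⟨by omega, h⟩
      have h4 := fun j => Nat.find_min hex (m := j)
      generalize Nat.find hex = k at h1 h2 h3 h4
      obtain ⟨k, rfl⟩ := Nat.exists_eq_add_of_le' h1
      refine ⟨k, by omega, ⟨h2, fun j hj1 hj hs => h4 j hj ⟨hj1, hs⟩⟩, ?_⟩
      rwa [show k + 1 + (n - k) = n + 1 by omega]
    · rintro ⟨k, hk, -, h⟩
      rwa [show k + 1 + (n - k) = n + 1 by omega] at h
  have hfirst : ∀ k, NullMeasurableSet {ω | FirstSplitsAt (π ω) k} μ := fun k => by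
    simp only [firstSplitsAt_iff]
    exact (measure_firstValues_mem hW hP hPW hπ (Finset.filter_subset _ _)).1
  rw [renewalProb, he, measureReal_def, measure_biUnion_finset₀, ENNReal.toReal_sum]
  · refine Finset.sum_congr rfl fun k _ => ?_
    rw [measure_firstSplitsAt_and_splitsAt hm hW hind hlaw hP hPW hπ, ENNReal.toReal_mul]
    rfl
  · exact fun k _ => measure_ne_top _ _
  · intro k _ k' _ hkk
    refine Disjoint.aedisjoint (Set.disjoint_left.2 fun ω h1 h2 => ?_)
    rcases lt_or_gt_of_ne hkk with h | h
    · exact h2.1.2 (k + 1) (by omega) (by omega) h1.1.1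
    · exact h1.1.2 (k' + 1) (by omega) (by omega) h2.1.1
  · exact fun k _ => (hfirst _).inter (nullMeasurableSet_splitsAt hW hP hPW hπ _)

/-- If the renewal probabilities have a positive limit, then the mean length of the first
component is the inverse of that limit. -/
theorem lintegral_firstComponentLength (hm : ∀ i, Measurable (W i))
    (hW : ∀ i ω, W i ω ∈ Set.Ioo (0 : ℝ) 1) (hind : iIndepFun W μ) (hlaw : ∀ i, μ.map (W i) = ν)
    (hP : Measurable P) (hPW : ∀ᵐ ω ∂μ, P ω = stickBreaking fun i => W i ω)
    (hπ : IsBiasedPermutation μ P π) {l : ℝ} (hl : 0 < l)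
    (hlim : Tendsto (renewalProb μ π) atTop (𝓝 l)) :
    ∫⁻ ω, (firstComponentLength (π ω) : ℝ≥0∞) ∂μ = ENNReal.ofReal (1 / l) := by
  set N : ℕ → Set Ω := fun k => {ω | ∀ j, 1 ≤ j → j ≤ k → ¬ SplitsAt (π ω) j} with hN
  have hsplit := nullMeasurableSet_splitsAt hW hP hPW hπ
  have hNm : ∀ k, NullMeasurableSet (N k) μ := fun k => by
    have : N k = ⋂ j ∈ Finset.Icc 1 k, {ω | SplitsAt (π ω) j}ᶜ := by
      ext ω
      simp [hN]
    rw [this]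
    exact .biInter (Set.to_countable _) fun j _ => (hsplit j).compl
  have hg : ∀ k, μ.real (N k) =
      μ.real (N (k + 1)) + μ.real {ω | FirstSplitsAt (π ω) (k + 1)} := by
    intro k
    rw [← measureReal_inter_add_sdiff₀ (s := N k) (hsplit (k + 1)), add_comm]
    congr 2
    · ext ω
      constructor
      · rintro ⟨h1, h2⟩ j hj1 hj
        rcases Nat.le_succ_iff.1 hj with h | rfl
        · exact h1 j hj1 h
        · exact h2
      · exact fun h => ⟨fun j hj1 hj => h j hj1 (by omega), h _ (by omega) le_rfl⟩
    · ext ω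
      constructor
      · exact fun ⟨h1, h2⟩ => ⟨h2, fun j hj1 hj => h1 j hj1 (by omega)⟩
      · exact fun ⟨h1, h2⟩ => ⟨fun j hj1 hj => h2 j hj1 (by omega), h1⟩
  have hg0 : μ.real (N 0) = 1 := by
    have : N 0 = Set.univ := Set.eq_univ_of_forall fun ω j h1 h2 => by omega
    rw [this, probReal_univ]
  have hu0 : renewalProb μ π 0 = 1 := by
    have : {ω | SplitsAt (π ω) 0} = Set.univ := Set.eq_univ_of_forall fun ω j h => by omega
    rw [renewalProb, this, probReal_univ]
  have hsum := hasSum_of_renewal (g := fun k => μ.real (N k)) (fun k => measureReal_nonneg)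
    (fun n => measureReal_nonneg) (fun n => measureReal_le_one) hl hlim
    (sum_mul_eq_one_of_renewal (f := fun k => μ.real {ω | FirstSplitsAt (π ω) k}) hu0 hg0 hg
      (renewalProb_succ hm hW hind hlaw hP hPW hπ))
  have hind' : ∀ ω k, {k : ℕ | ∀ j, 1 ≤ j → j ≤ k → ¬ SplitsAt (π ω) j}.indicator
      (1 : ℕ → ℝ≥0∞) k = (N k).indicator 1 ω := fun ω k => rfl
  simp only [firstComponentLength_eq_tsum, hind']
  have hmeas : ∀ k, AEMeasurable ((N k).indicator (1 : Ω → ℝ≥0∞)) μ := fun k =>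
    aemeasurable_const.indicator₀ (hNm k)
  rw [lintegral_tsum hmeas]
  simp only [lintegral_indicator_one₀ (hNm _)]
  rw [← hsum.tsum_eq, ENNReal.ofReal_tsum_of_nonneg (fun k => measureReal_nonneg) hsum.summable]
  simp

end Length

/-! ### Limit of the renewal probabilities -/

theorem ae_betaMeasure_mem_Ioo (a b : ℝ) : ∀ᵐ x ∂(betaMeasure a b), x ∈ Set.Ioo (0 : ℝ) 1 := by
  have hmeas : Measurable (betaPDF a b) := (measurable_betaPDFReal a b).ennreal_ofReal
  rw [betaMeasure, ae_withDensity_iff hmeas]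
  refine ae_of_all _ fun x hx => ?_
  by_contra h
  rw [Set.mem_Ioo] at h
  exact hx (by rw [betaPDF_eq, if_neg h, ENNReal.ofReal_zero])

/-- The residual factors of a GEM sequence can be chosen measurable, with values in `(0, 1)`. -/
theorem IsGEM.exists_measurable_factors {Ω : Type*} [MeasurableSpace Ω] {μ : Measure Ω} {θ : ℝ}
    {P : Ω → ℕ → ℝ} (hP : IsGEM θ μ P) :
    ∃ W : ℕ → Ω → ℝ, (∀ i, Measurable (W i)) ∧ (∀ i ω, W i ω ∈ Set.Ioo (0 : ℝ) 1) ∧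
      iIndepFun W μ ∧ (∀ i, μ.map (W i) = betaMeasure 1 θ) ∧
      ∀ᵐ ω ∂μ, P ω = stickBreaking fun i => W i ω := by
  classical
  obtain ⟨-, W, hind, hlaw, hPW⟩ := hP
  set V : ℕ → Ω → ℝ := fun i => (hlaw i).aemeasurable.mk (W i) with hV
  have hVm : ∀ i, Measurable (V i) := fun i => (hlaw i).aemeasurable.measurable_mk
  have hmem : ∀ i, ∀ᵐ ω ∂μ, W i ω ∈ Set.Ioo (0 : ℝ) 1 := fun i => by
    refine ae_of_ae_map (hlaw i).aemeasurable ?_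
    rw [(hlaw i).map_eq]
    exact ae_betaMeasure_mem_Ioo 1 θ
  have hae : ∀ i, W i =ᵐ[μ] fun ω => if V i ω ∈ Set.Ioo (0 : ℝ) 1 then V i ω else 1 / 2 := by
    intro i
    filter_upwards [(hlaw i).aemeasurable.ae_eq_mk, hmem i] with ω h1 h2
    have h3 : W i ω = V i ω := h1
    rw [← h3, if_pos h2]
  refine ⟨fun i ω => if V i ω ∈ Set.Ioo (0 : ℝ) 1 then V i ω else 1 / 2,
    fun i => ?_, fun i ω => ?_, hind.congr hae, fun i => ?_, ?_⟩
  · exact Measurable.ite (hVm i measurableSet_Ioo) (hVm i) measurable_const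
  · dsimp only
    split_ifs with h
    · exact h
    · norm_num
  · rw [← Measure.map_congr (hae i), (hlaw i).map_eq]
  · filter_upwards [hPW, ae_all_iff.2 hae] with ω h1 h2
    rw [h1]
    exact congrArg stickBreaking (funext h2)

theorem mainTheorem5 {Ω : Type*} [MeasurableSpace Ω] (μ : Measure Ω) [IsProbabilityMeasure μ]
    (θ : ℝ) (hθ : 0 < θ) (P : Ω → ℕ → ℝ) (hP : IsGEM θ μ P)
    (π : Ω → Equiv.Perm ℕ) (hπ : IsBiasedPermutation μ P π) :
    ∃ u : ℝ, Tendsto (renewalProb μ π) atTop (𝓝 u) ∧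
      Multipliable (fun j : ℕ =>
        ((j : ℝ) + 2) * ((j : ℝ) + 2 + 2 * θ) / ((j : ℝ) + 2 + θ) ^ 2) ∧
      u = 1 / (1 + θ) *
        ∏' j : ℕ, ((j : ℝ) + 2) * ((j : ℝ) + 2 + 2 * θ) / ((j : ℝ) + 2 + θ) ^ 2 ∧
      u = Real.Gamma (θ + 2) * Real.Gamma (θ + 1) / Real.Gamma (2 * θ + 2) ∧
      (θ = 1 → u = 1 / 3 ∧
        ∫⁻ ω, (firstComponentLength (π ω) : ℝ≥0∞) ∂μ = 3) := by
  obtain ⟨W, hm, hW, hind, hlaw, hPW⟩ := hP.exists_measurable_factors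
  have hpos : 0 < Real.Gamma (θ + 2) * Real.Gamma (θ + 1) / Real.Gamma (2 * θ + 2) :=
    div_pos (mul_pos (Real.Gamma_pos_of_pos (by positivity))
      (Real.Gamma_pos_of_pos (by positivity))) (Real.Gamma_pos_of_pos (by positivity))
  have hlim : Tendsto (renewalProb μ π) atTop
      (𝓝 (Real.Gamma (θ + 2) * Real.Gamma (θ + 1) / Real.Gamma (2 * θ + 2))) := by
    have h := (ENNReal.tendsto_toReal ENNReal.ofReal_ne_top).comp (tendsto_lintegral_damping hθ)
    rw [ENNReal.toReal_ofReal hpos.le] at h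
    refine h.congr fun n => ?_
    rw [Function.comp, ← measure_splitsAt_eq_lintegral_damping hθ hm hW hind hlaw hP.1 hPW hπ n]
    rfl
  refine ⟨_, hlim, multipliable_gamma_product hθ, ?_, rfl, ?_⟩
  · rw [tprod_gamma_product hθ, show θ + 2 = (θ + 1) + 1 by ring,
      Real.Gamma_add_one (s := θ + 1) (by positivity)]
    field_simp
    ring
  · rintro rfl
    have h3 : Real.Gamma (1 + 2) * Real.Gamma (1 + 1) / Real.Gamma (2 * 1 + 2) = 1 / 3 := by
      rw [show (1 : ℝ) + 2 = (2 : ℕ) + 1 by norm_num, show (1 : ℝ) + 1 = (1 : ℕ) + 1 by norm_num,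
        show (2 : ℝ) * 1 + 2 = (3 : ℕ) + 1 by norm_num, Real.Gamma_nat_eq_factorial,
        Real.Gamma_nat_eq_factorial, Real.Gamma_nat_eq_factorial]
      norm_num [Nat.factorial]
    refine ⟨h3, ?_⟩
    rw [lintegral_firstComponentLength hm hW hind hlaw hP.1 hPW hπ hpos hlim, h3]
    norm_num
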